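/- Let $(R,\mathfrak m)$ be a commutative Noetherian local ring and let $M$ be a finitely generated $R$-module with $d=\dim M\ge 2$. Let $H^0_{\mathfrak m}(M)=\bigcup_{n\ge 0}(0:_M\mathfrak m^n)$ be the zeroth local cohomology module of $M$ with respect to $\mathfrak m$. For $n\ge 1$ put $$\Lambda_{d,n}=\Big\{(\alpha_1,\dots,\alpha_d)\in\mathbb Z^d \;\Big|\; \alpha_i\ge 1 \text{ for all } i,\ \sum_{i=1}^d\alpha_i=d+n-1\Big\}.$$ A system of parameters $x_1,\dots,x_d$ of $M$ (that is, $d=\dim M$ elements of $\mathfrak m$ with $\dim M/(x_1,\dots,x_d)M=0$) is said to have the property of parametric decomposition if $$(x_1,\dots,x_d)^nM=\bigcap_{\alpha\in\Lambda_{d,n}}(x_1^{\alpha_1},\dots,x_d^{\alpha_d})M\qquad\text{for all } n\ge 1.$$ Then the following statements are equivalent: (i) $M/H^0_{\mathfrak m}(M)$ is a Cohen–Macaulay module and $\mathfrak m H^0_{\mathfrak m}(M)=0$. (ii) Every system of parameters of $M$ has the property of parametric decomposition. -/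

import Mathlib

namespace ParametricDecomposition

open IsLocalRing

universe u v

/-- The zeroth local cohomology module `H⁰_I(M) = ⋃ₙ (0 :_M Iⁿ)`, as a submodule of `M`:
the elements of `M` that are annihilated by some power of `I`. -/
noncomputable def H0 {R : Type u} [CommRing R] (I : Ideal R)
    (M : Type v) [AddCommGroup M] [Module R M] : Submodule R M :=
  Ideal.primaryComponent M I

theorem mem_H0_iff {R : Type u} [CommRing R] (I : Ideal R)
    (M : Type v) [AddCommGroup M] [Module R M] (m : M) :
    m ∈ H0 I M ↔ ∃ n : ℕ, ∀ r ∈ I ^ n, r • m = 0 := by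
  simp [H0, Ideal.primaryComponent_mem, Submodule.mem_torsionBySet_iff]

/-- The depth of a module over a local ring: the supremum of the lengths of the `M`-regular
sequences contained in the maximal ideal. -/
noncomputable def depth (R : Type u) [CommRing R] [IsLocalRing R]
    (M : Type v) [AddCommGroup M] [Module R M] : ℕ∞ :=
  ⨆ (rs : List R) (_ : RingTheory.Sequence.IsRegular M rs ∧ ∀ r ∈ rs, r ∈ maximalIdeal R),
    (rs.length : ℕ∞)

/-- `M` is Cohen–Macaulay: `M = 0`, or `depth M = dim M`. -/
def IsCohenMacaulay (R : Type u) [CommRing R] [IsLocalRing R]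
    (M : Type v) [AddCommGroup M] [Module R M] : Prop :=
  Subsingleton M ∨ (depth R M : WithBot ℕ∞) = Module.supportDim R M

/-- `x₁, …, x_d` is a system of parameters of `M`: `d = dim M`, all `xᵢ` lie in the maximal
ideal, and `dim M / (x₁, …, x_d) M = 0`. -/
structure IsSystemOfParameters (R : Type u) [CommRing R] [IsLocalRing R]
    (M : Type v) [AddCommGroup M] [Module R M] {d : ℕ} (x : Fin d → R) : Prop where
  dim_eq : Module.supportDim R M = d
  mem_maximalIdeal : ∀ i, x i ∈ maximalIdeal R
  dim_quotient_eq_zero :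
    Module.supportDim R (M ⧸ (Ideal.span (Set.range x) • ⊤ : Submodule R M)) = 0

/-- The index set `Λ_{d,n}` of tuples of `d` integers `αᵢ ≥ 1` with `∑ αᵢ = d + n - 1`. -/
def Lam (d n : ℕ) : Set (Fin d → ℕ) :=
  {α | (∀ i, 1 ≤ α i) ∧ (∑ i, α i) + 1 = d + n}

/-- `x₁, …, x_d` has the property of parametric decomposition on `M`:
`qⁿ M = ⋂_{α ∈ Λ_{d,n}} (x₁^α₁, …, x_d^α_d) M` for all `n ≥ 1`, where `q = (x₁, …, x_d)`. -/
def HasParametricDecomposition (R : Type u) [CommRing R]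
    (M : Type v) [AddCommGroup M] [Module R M] {d : ℕ} (x : Fin d → R) : Prop :=
  ∀ n : ℕ, 1 ≤ n →
    (Ideal.span (Set.range x) ^ n • ⊤ : Submodule R M) =
      ⨅ α ∈ Lam d n, (Ideal.span (Set.range fun i => x i ^ α i) • ⊤ : Submodule R M)

end ParametricDecomposition

/-! Write `H` for the zeroth local cohomology and `𝔪` for the maximal ideal.

From (i) to (ii): `H` is killed by `𝔪`, so `M` and `M/H` have the same support, and a system of
parameters of `M` is one of the Cohen–Macaulay module `M/H`. There it is a regular sequence, and so
is every rearrangement in which some members are replaced by powers. The monomial argument for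
regular sequences (`IsStronglyRegular.mem_sup_pow_smul`) then puts an element `w` of the
intersection into `H + qⁿM`. The `H`-component of `w` lies in `H ∩ (x₁^α₁, …, x_d^α_d)M`, which
vanishes by `IsStronglyRegular.eq_zero_of_mem`.

From (ii) to (i): only the exponent `n = 2` is needed, but for many systems of parameters. A
suitable `w` is shown to lie in every `(y₁, …, y_j², …, y_d)M`, hence in `(y₁, …, y_d)²M`; the
superfluous `y_i` are taken in high powers of `𝔪` and disappear by Krull's intersection theorem. If
`x₀u = 0`, this gives `x₁u ∈ x₁²M` (`exists_smul_eq_sq_smul`). Applied to general elements, with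
Nakayama and prime avoidance, it yields `𝔪H = 0` and a parameter regular modulo `H`. Two further
applications give the induction step `mem_initialIdeal_sup_succ`: a system of parameters beginning
with that element is weakly regular on `M/H`. -/

namespace ParametricDecomposition

open IsLocalRing Submodule RingTheory.Sequence
open scoped Pointwise

universe u v

/-! ### Parameters via supports, prime avoidance, Krull and Nakayama. -/

section Local

variable {R : Type u} [CommRing R] [IsLocalRing R] {M : Type v} [AddCommGroup M] [Module R M]

/-- The maximal ideal is the only prime of the support of `M` that contains `s`. -/
def IsPrimaryOn (M : Type v) [AddCommGroup M] [Module R M] (s : Set R) : Prop :=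
  ∀ p ∈ Module.support R M, s ⊆ p.asIdeal → p.asIdeal = maximalIdeal R

theorem IsPrimaryOn.supportDim_le_zero (h : IsPrimaryOn (R := R) M ∅) :
    Module.supportDim R M ≤ 0 := by
  have : Subsingleton (Module.support R M) := ⟨fun p q => Subtype.ext (PrimeSpectrum.ext
    ((h _ p.2 (Set.empty_subset _)).trans (h _ q.2 (Set.empty_subset _)).symm))⟩
  exact Order.krullDim_nonpos_of_subsingleton

theorem isPrimaryOn_quotSMulTop [Module.Finite R M] {a : R} {s : Set R}
    (h : IsPrimaryOn M (insert a s)) : IsPrimaryOn (QuotSMulTop a M) s := by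
  intro p hp hs
  rw [Module.support_quotSMulTop] at hp
  refine h p hp.1 (Set.insert_subset ?_ hs)
  exact hp.2 (Set.mem_singleton a)

theorem isPrimaryOn_insert [Module.Finite R M] {a : R} {s : Set R}
    (h : IsPrimaryOn (QuotSMulTop a M) s) : IsPrimaryOn M (insert a s) := by
  intro p hp hs
  refine h p ?_ ((Set.subset_insert _ _).trans hs)
  rw [Module.support_quotSMulTop]
  exact ⟨hp, fun x hx => by rw [Set.mem_singleton_iff.mp hx]; exact hs (Set.mem_insert _ _)⟩

/-- Replacing a system of parameters by elements whose ideal contains powers of the old ones. -/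
theorem IsPrimaryOn.of_pow_mem {s t : Set R} (h : IsPrimaryOn M s)
    (ht : ∀ a ∈ s, ∃ k : ℕ, a ^ k ∈ Ideal.span t) : IsPrimaryOn M t := by
  intro p hp hs
  refine h p hp fun a ha => ?_
  obtain ⟨k, hk⟩ := ht a ha
  exact p.2.mem_of_pow_mem k (Ideal.span_le.mpr hs hk)

variable [IsNoetherianRing R] [Module.Finite R M]

theorem IsPrimaryOn.supportDim_le {rs : List R} (hrs : ∀ r ∈ rs, r ∈ maximalIdeal R)
    (h : IsPrimaryOn M {r | r ∈ rs}) : Module.supportDim R M ≤ rs.length := by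
  induction rs generalizing M with
  | nil => simpa using IsPrimaryOn.supportDim_le_zero (by simpa using h)
  | cons a rs ih =>
    have h' : IsPrimaryOn (QuotSMulTop a M) {r | r ∈ rs} :=
      isPrimaryOn_quotSMulTop (by convert h using 1; ext; simp)
    refine (Module.supportDim_le_supportDim_quotSMulTop_succ (hrs a (by simp))).trans ?_
    have := ih (fun r hr => hrs r (by simp [hr])) h'
    push_cast [List.length_cons]
    gcongr

omit [IsNoetherianRing R] in
theorem isSystemOfParameters_iff {d : ℕ} {x : Fin d → R} :
    IsSystemOfParameters R M x ↔ Module.supportDim R M = d ∧ (∀ i, x i ∈ maximalIdeal R) ∧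
      IsPrimaryOn M (Set.range x) := by
  have hspan : ∀ p : PrimeSpectrum R,
      p ∈ Module.support R (M ⧸ (Ideal.span (Set.range x) • ⊤ : Submodule R M)) ↔
        p ∈ Module.support R M ∧ Set.range x ⊆ p.asIdeal := by
    intro p
    rw [Module.support_quotient, PrimeSpectrum.zeroLocus_span]
    rfl
  constructor
  · rintro ⟨h1, h2, h3⟩
    refine ⟨h1, h2, fun p hp hs => ?_⟩
    have := (support_of_supportDim_eq_zero R _ h3).le ((hspan p).mpr ⟨hp, hs⟩)
    exact le_antisymm (le_maximalIdeal p.2.ne_top) this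
  · rintro ⟨h1, h2, h3⟩
    refine ⟨h1, h2, le_antisymm (IsPrimaryOn.supportDim_le_zero ?_) ?_⟩
    · intro p hp _
      rw [hspan] at hp
      exact h3 p hp.1 hp.2
    · have hM : Nontrivial M := by
        rw [← Module.supportDim_ne_bot_iff_nontrivial R, h1]
        exact WithBot.natCast_ne_bot d
      have : Nontrivial (M ⧸ (Ideal.span (Set.range x) • ⊤ : Submodule R M)) := by
        refine Submodule.Quotient.nontrivial_iff.mpr (Ne.symm ?_)
        refine Submodule.top_ne_ideal_smul_of_le_jacobson_annihilator
          ((Ideal.span_le.mpr ?_).trans (maximalIdeal_le_jacobson _))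
        rintro _ ⟨i, rfl⟩
        exact h2 i
      have h0 := Module.supportDim_ne_bot_of_nontrivial R
        (M ⧸ (Ideal.span (Set.range x) • ⊤ : Submodule R M))
      obtain ⟨n, hn⟩ := WithBot.ne_bot_iff_exists.mp h0
      rw [← hn]
      exact WithBot.coe_le_coe.mpr (zero_le)

-- Prime avoidance allows the ideal `J`, which need not be prime, among the covering ideals of `𝔪`.
-- This passes from general elements of `𝔪` to all of `𝔪`.
omit [IsNoetherianRing R] in
theorem maximalIdeal_le_of_forall_notMem {P : Set (Ideal R)} (hfin : P.Finite)
    (hP : ∀ p ∈ P, p.IsPrime) (hm : maximalIdeal R ∉ P) {J : Ideal R}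
    (hJ : ∀ b ∈ maximalIdeal R, (∀ p ∈ P, b ∉ p) → b ∈ J) : maximalIdeal R ≤ J := by
  have hsub : (maximalIdeal R : Set R) ⊆ ⋃ p ∈ insert J P, ((id p : Ideal R) : Set R) := by
    intro b hb
    by_cases h : ∀ p ∈ P, b ∉ p
    · exact Set.mem_biUnion (Set.mem_insert _ _) (hJ b hb h)
    · push Not at h
      obtain ⟨p, hp, hbp⟩ := h
      exact Set.mem_biUnion (Set.mem_insert_of_mem _ hp) hbp
  obtain ⟨p, rfl | hp, hle⟩ := (Ideal.subset_union_prime_finite (hfin.insert J) (f := id) J J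
    (fun i hi hne _ => hP i (hi.resolve_left hne))).mp hsub
  · exact hle
  · have := (maximalIdeal.isMaximal R).eq_of_le (hP p hp).ne_top hle
    exact absurd hp (by simpa [← this] using hm)

omit [IsNoetherianRing R] in
theorem exists_mem_maximalIdeal_forall_notMem {P : Set (Ideal R)} (hfin : P.Finite)
    (hP : ∀ p ∈ P, p.IsPrime) (hm : maximalIdeal R ∉ P) :
    ∃ b ∈ maximalIdeal R, ∀ p ∈ P, b ∉ p := by
  by_contra! h
  have h1 : maximalIdeal R ≤ ⊥ := maximalIdeal_le_of_forall_notMem hfin hP hm fun b hb hb' => by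
    obtain ⟨p, hp, hbp⟩ := h b hb
    exact absurd hbp (hb' p hp)
  obtain ⟨p, hp, -⟩ := h 0 (zero_mem _)
  have := (maximalIdeal.isMaximal R).eq_of_le (hP p hp).ne_top (h1.trans bot_le)
  exact hm (this ▸ hp)

omit [IsNoetherianRing R] in
theorem maximalIdeal_notMem_minimalPrimes (h : 1 ≤ Module.supportDim R M) :
    maximalIdeal R ∉ (Module.annihilator R M).minimalPrimes := by
  intro hm
  have : IsPrimaryOn (R := R) M ∅ := fun p hp _ =>
    le_antisymm (le_maximalIdeal p.2.ne_top)
      (hm.2 ⟨p.2, Module.mem_support_iff_of_finite.mp hp⟩ (le_maximalIdeal p.2.ne_top))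
  exact absurd (h.trans this.supportDim_le_zero) (by decide)

theorem supportDim_quotSMulTop_eq {d : ℕ} {a : R} (hd : Module.supportDim R M = (d + 1 : ℕ))
    (ha : a ∈ maximalIdeal R) (h : ∀ p ∈ (Module.annihilator R M).minimalPrimes, a ∉ p) :
    Module.supportDim R (QuotSMulTop a M) = d := by
  have h1 :=
    Module.supportDim_quotSMulTop_succ_eq_of_notMem_minimalPrimes_of_mem_maximalIdeal h ha
  rw [hd] at h1
  have h2 : Module.supportDim R (QuotSMulTop a M) ≠ ⊥ := by
    intro h2
    rw [h2, WithBot.bot_add] at h1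
    exact WithBot.natCast_ne_bot _ h1.symm
  obtain ⟨n, hn⟩ := WithBot.ne_bot_iff_exists.mp h2
  rw [← hn] at h1 ⊢
  have h3 : n + 1 = ((d + 1 : ℕ) : ℕ∞) := by exact_mod_cast h1
  have hn' : n ≠ ⊤ := by
    rintro rfl
    exact ENat.natCast_ne_top _ (h3.symm.trans (top_add 1))
  lift n to ℕ using hn'
  norm_cast at h3 ⊢
  omega

theorem exists_isPrimaryOn_range {d : ℕ} (hd : Module.supportDim R M = d) :
    ∃ x : Fin d → R, (∀ i, x i ∈ maximalIdeal R) ∧ IsPrimaryOn M (Set.range x) := by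
  induction d generalizing M with
  | zero =>
    refine ⟨Fin.elim0, fun i => i.elim0, fun p hp _ => ?_⟩
    have := (support_of_supportDim_eq_zero R M (by simpa using hd)).le hp
    exact le_antisymm (le_maximalIdeal p.2.ne_top) this
  | succ d ih =>
    obtain ⟨a, ha, ha'⟩ := exists_mem_maximalIdeal_forall_notMem
      (Ideal.finite_minimalPrimes_of_isNoetherianRing R (Module.annihilator R M))
      (fun p hp => hp.1.1) (maximalIdeal_notMem_minimalPrimes (M := M) (by
        rw [hd]; exact_mod_cast Nat.succ_le_succ (Nat.zero_le d)))
    obtain ⟨x, hx, hx'⟩ := ih (supportDim_quotSMulTop_eq hd ha ha')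
    refine ⟨Fin.cons a x, fun i => Fin.cases ha hx i, ?_⟩
    rw [Fin.range_cons]
    exact isPrimaryOn_insert hx'

/-- Krull's intersection theorem for the quotient by a submodule. -/
theorem mem_of_forall_mem_sup_pow_smul {L : Submodule R M} {w : M} (s₀ : ℕ)
    (h : ∀ s, s₀ ≤ s → w ∈ L ⊔ maximalIdeal R ^ s • (⊤ : Submodule R M)) : w ∈ L := by
  have hbot := Ideal.iInf_pow_smul_eq_bot_of_isLocalRing (M := M ⧸ L) (maximalIdeal R)
    (Ideal.IsPrime.ne_top inferInstance)
  have : L.mkQ w ∈ (⨅ i : ℕ, maximalIdeal R ^ i • ⊤ : Submodule R (M ⧸ L)) := by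
    rw [Submodule.mem_iInf]
    intro i
    obtain ⟨l, hl, y, hy, rfl⟩ := Submodule.mem_sup.mp (h (max i s₀) (le_max_right _ _))
    rw [map_add, show L.mkQ l = 0 by simpa using hl, zero_add]
    have h1 : y ∈ maximalIdeal R ^ i • (⊤ : Submodule R M) :=
      Submodule.smul_mono_left (Ideal.pow_le_pow_right (le_max_left _ _)) hy
    have h2 := Submodule.mem_map_of_mem (f := L.mkQ) h1
    rw [Submodule.map_smul''] at h2
    exact Submodule.smul_mono le_rfl le_top h2
  rw [hbot] at this
  simpa using this

-- The ascending chain of colons `(L : z^k)` in `M` stabilizes at some `K`.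
omit [IsLocalRing R] in
theorem exists_forall_pow_smul_mem (L : Submodule R M) (z : R) :
    ∃ K : ℕ, ∀ k, ∀ v : M, z ^ k • v ∈ L → z ^ K • v ∈ L := by
  have hmono : Monotone fun k : ℕ => L.comap (LinearMap.lsmul R M (z ^ k)) := by
    refine monotone_nat_of_le_succ fun k v hv => ?_
    simp only [Submodule.mem_comap, LinearMap.lsmul_apply] at hv ⊢
    rw [pow_succ', mul_smul]
    exact L.smul_mem _ hv
  obtain ⟨K, hK⟩ := monotone_stabilizes_iff_noetherian.mpr (inferInstance : IsNoetherian R M)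
    ⟨_, hmono⟩
  refine ⟨K, fun k v hv => ?_⟩
  have h1 := hmono (le_max_left k K) (show v ∈ L.comap (LinearMap.lsmul R M (z ^ k)) from hv)
  have h2 := hK (max k K) (le_max_right _ _)
  exact h2.ge h1

omit [IsNoetherianRing R] [Module.Finite R M] in
theorem eq_bot_of_le_smul {W : Submodule R M} (hW : W.FG) {a : R} (ha : a ∈ maximalIdeal R)
    (h : ∀ w ∈ W, ∃ v ∈ W, w = a • v) : W = ⊥ := by
  refine Submodule.eq_bot_of_le_smul_of_le_jacobson_bot (maximalIdeal R) W hW ?_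
    (maximalIdeal_le_jacobson _)
  intro w hw
  obtain ⟨v, hv, rfl⟩ := h w hw
  exact Submodule.smul_mem_smul ha hv

end Local

/-! ### Parametric decomposition for the exponent 2. -/

section Square

variable {R : Type u} [CommRing R] {M : Type v} [AddCommGroup M] [Module R M]

theorem exists_of_mem_Lam_two {d : ℕ} {α : Fin d → ℕ} (hα : α ∈ Lam d 2) :
    ∃ j, α j = 2 ∧ ∀ i, i ≠ j → α i = 1 := by
  obtain ⟨h1, h2⟩ := hα
  have h3 : ∑ i, (α i - 1) = 1 := by
    have : ∑ i, α i = ∑ i, (α i - 1) + d := by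
      calc ∑ i, α i = ∑ i, ((α i - 1) + 1) :=
            Finset.sum_congr rfl fun i _ => (Nat.sub_add_cancel (h1 i)).symm
        _ = ∑ i, (α i - 1) + d := by simp [Finset.sum_add_distrib]
    omega
  obtain ⟨j, -, hj⟩ := Finset.exists_ne_zero_of_sum_ne_zero (h3.trans_ne one_ne_zero)
  have h4 := Finset.add_sum_erase Finset.univ (fun i => α i - 1) (Finset.mem_univ j)
  have h5 : ∑ i ∈ Finset.univ.erase j, (α i - 1) = 0 := by omega
  refine ⟨j, by omega, fun i hi => ?_⟩
  have := Finset.sum_eq_zero_iff.mp h5 i (by simpa using hi)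
  have := h1 i
  omega

/-- The tuples in `Lam d 2` have one entry 2 and all others 1. This is the only form in which the
necessity proof uses the decomposition property. -/
theorem HasParametricDecomposition.mem_sq {d : ℕ} {y : Fin d → R}
    (h : HasParametricDecomposition R M y) {w : M}
    (hw : ∀ j, w ∈ (Ideal.span (Set.range (Function.update y j (y j ^ 2))) • ⊤ :
      Submodule R M)) :
    w ∈ (Ideal.span (Set.range y) ^ 2 • ⊤ : Submodule R M) := by
  rw [h 2 one_le_two]
  simp only [Submodule.mem_iInf]
  intro α hα
  obtain ⟨j, hj, hj'⟩ := exists_of_mem_Lam_two hα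
  convert hw j using 5 with i
  by_cases hi : i = j
  · subst hi
    simp [hj]
  · simp [hi, hj' i hi]

theorem sq_smul_le_of_le_sup {I A B : Ideal R} (h : I ≤ A ⊔ B) :
    (I ^ 2 • ⊤ : Submodule R M) ≤ A ^ 2 • ⊤ ⊔ B • ⊤ := by
  rw [← Submodule.sup_smul]
  refine Submodule.smul_mono_left ((Ideal.pow_right_mono h 2).trans ?_)
  simp only [pow_two, Ideal.sup_mul, Ideal.mul_sup]
  refine sup_le (sup_le le_sup_left ?_) (sup_le ?_ ?_)
  · exact le_sup_of_le_right Ideal.mul_le_left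
  · exact le_sup_of_le_right Ideal.mul_le_right
  · exact le_sup_of_le_right Ideal.mul_le_right

end Square

/-! ### From parametric decomposition to regularity modulo `H⁰`. -/

section Necessity

variable {R : Type u} [CommRing R] [IsLocalRing R] [IsNoetherianRing R]
  {M : Type v} [AddCommGroup M] [Module R M] [Module.Finite R M]

/-- The element `x₁u` equals both `x₁ • u` and `(x₀^s + x₁) • u`. With both multipliers as
parameters, squaring one parameter always leaves one of the two expressions available. -/
theorem exists_smul_eq_sq_smul
    (hP : ∀ (d : ℕ) (x : Fin d → R), IsSystemOfParameters R M x →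
      HasParametricDecomposition R M x)
    {e : ℕ} {x : Fin (e + 2) → R} (hx : IsSystemOfParameters R M x) {u : M}
    (hu : x 0 • u = 0) : ∃ v : M, x 1 • u = x 1 ^ 2 • v := by
  obtain ⟨hdim, hmem, hprim⟩ := isSystemOfParameters_iff.mp hx
  suffices h : x 1 • u ∈ (Ideal.span {x 1} ^ 2 • ⊤ : Submodule R M) by
    rw [Ideal.span_singleton_pow, Submodule.ideal_span_singleton_smul] at h
    obtain ⟨v, -, hv⟩ := h
    exact ⟨v, hv.symm⟩
  refine mem_of_forall_mem_sup_pow_smul 1 fun s hs => ?_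
  -- All members but `x 1` are congruent to `x 1` or to `0` modulo `𝔪^s`, so `(y)²M` lies in `x₁²M +
  -- 𝔪^s M`.
  set y : Fin (e + 2) → R := fun i =>
    if i = 0 then x 1 else if i = 1 then x 0 ^ s + x 1 else x i ^ s with hy
  have hs0 : s ≠ 0 := by omega
  have hy0 : y 0 = x 1 := by simp [hy]
  have hy1 : y 1 = x 0 ^ s + x 1 := by simp [hy]
  have hy2 : ∀ i, i ≠ 0 → i ≠ 1 → y i = x i ^ s := fun i h0 h1 => by simp [hy, h0, h1]
  have hys : ∀ i, y i ∈ Ideal.span (Set.range y) := fun i => Ideal.subset_span ⟨i, rfl⟩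
  have hysop : IsSystemOfParameters R M y := by
    refine isSystemOfParameters_iff.mpr ⟨hdim, fun i => ?_, hprim.of_pow_mem ?_⟩
    · by_cases h0 : i = 0
      · rw [h0, hy0]; exact hmem 1
      · by_cases h1 : i = 1
        · rw [h1, hy1]; exact add_mem (Ideal.pow_mem_of_mem _ (hmem 0) s hs) (hmem 1)
        · rw [hy2 i h0 h1]; exact Ideal.pow_mem_of_mem _ (hmem i) s hs
    · rintro _ ⟨i, rfl⟩
      refine ⟨s, ?_⟩
      by_cases h0 : i = 0
      · rw [h0, show x 0 ^ s = y 1 - y 0 by rw [hy1, hy0]; ring]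
        exact sub_mem (hys 1) (hys 0)
      · by_cases h1 : i = 1
        · rw [h1, ← hy0]; exact Ideal.pow_mem_of_mem _ (hys 0) s hs
        · rw [← hy2 i h0 h1]; exact hys i
  have h01 : (0 : Fin (e + 2)) ≠ 1 := by simp
  have hw : x 1 • u ∈ (Ideal.span (Set.range y) ^ 2 • ⊤ : Submodule R M) := by
    refine (hP _ y hysop).mem_sq fun j => ?_
    by_cases hj : j = 0
    · have : x 1 • u = y 1 • u := by
        rw [hy1, add_smul, show x 0 ^ s = x 0 ^ (s - 1) * x 0 by
          rw [← pow_succ, Nat.sub_add_cancel hs], mul_smul, hu, smul_zero, zero_add]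
      rw [this]
      refine Submodule.smul_mem_smul (Ideal.subset_span ⟨1, ?_⟩) trivial
      rw [Function.update_of_ne (by rw [hj]; exact h01.symm)]
    · refine Submodule.smul_mem_smul (Ideal.subset_span ⟨0, ?_⟩) trivial
      rw [Function.update_of_ne (Ne.symm hj), hy0]
  refine sq_smul_le_of_le_sup (Ideal.span_le.mpr ?_) hw
  rintro _ ⟨i, rfl⟩
  have hb : x 1 ∈ Ideal.span {x 1} ⊔ maximalIdeal R ^ s :=
    Ideal.mem_sup_left (Ideal.mem_span_singleton_self _)
  by_cases h0 : i = 0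
  · rw [h0, hy0]; exact hb
  · by_cases h1 : i = 1
    · rw [h1, hy1]; exact add_mem (Ideal.mem_sup_right (Ideal.pow_mem_pow (hmem 0) s)) hb
    · rw [hy2 i h0 h1]; exact Ideal.mem_sup_right (Ideal.pow_mem_pow (hmem i) s)

/-- `𝔪 H⁰ = 0`, and there is a system of parameters starting with an element
that is regular modulo `H⁰`. -/
theorem exists_isSystemOfParameters_regular
    (hP : ∀ (d : ℕ) (x : Fin d → R), IsSystemOfParameters R M x →
      HasParametricDecomposition R M x)
    {e : ℕ} (hd : Module.supportDim R M = (e + 2 : ℕ)) :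
    (∀ r ∈ maximalIdeal R, ∀ h ∈ H0 (maximalIdeal R) M, r • h = 0) ∧
      ∃ x : Fin (e + 2) → R, IsSystemOfParameters R M x ∧
        ∀ v : M, x 0 • v ∈ H0 (maximalIdeal R) M → v ∈ H0 (maximalIdeal R) M := by
  set P := (Module.annihilator R M).minimalPrimes with hPdef
  have hfin : P.Finite := Ideal.finite_minimalPrimes_of_isNoetherianRing R _
  have hPp : ∀ p ∈ P, p.IsPrime := fun p hp => hp.1.1
  have hPm : maximalIdeal R ∉ P := maximalIdeal_notMem_minimalPrimes (by
    rw [hd]; exact_mod_cast Nat.succ_le_succ (Nat.zero_le _))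
  -- A maximal `U = (0 : a)` in this family will turn out to be `H⁰`: by maximality `(0 : ba) = U`,
  -- so every `b ∈ 𝔪` outside the minimal primes is regular modulo `U`.
  set 𝒮 : Set (Submodule R M) :=
    {U | ∃ a ∈ maximalIdeal R, (∀ p ∈ P, a ∉ p) ∧ U = torsionBy R M a}
  have hne : 𝒮.Nonempty := by
    obtain ⟨a, ha, ha'⟩ := exists_mem_maximalIdeal_forall_notMem hfin hPp hPm
    exact ⟨_, a, ha, ha', rfl⟩
  obtain ⟨U, ⟨a, ha, haP, hU⟩, hmax⟩ :=
    set_has_maximal_iff_noetherian.mpr (inferInstance : IsNoetherian R M) 𝒮 hne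
  have hreg : ∀ b ∈ maximalIdeal R, (∀ p ∈ P, b ∉ p) → ∀ v : M, b • v ∈ U → v ∈ U := by
    intro b hb hbP v hv
    have hmem : torsionBy R M (b * a) ∈ 𝒮 := ⟨b * a, Ideal.mul_mem_left _ _ ha,
      fun p hp h => ((hPp p hp).mem_or_mem h).elim (hbP p hp) (haP p hp), rfl⟩
    have hle : U ≤ torsionBy R M (b * a) := by
      intro z hz
      rw [hU, mem_torsionBy_iff] at hz
      rw [mem_torsionBy_iff, mul_smul, hz, smul_zero]
    have heq : U = torsionBy R M (b * a) := by
      by_contra hne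
      exact hmax _ hmem (lt_of_le_of_ne hle hne)
    rw [hU, mem_torsionBy_iff] at hv
    rw [heq, mem_torsionBy_iff, mul_comm, mul_smul, hv]
  have hdim1 : Module.supportDim R (QuotSMulTop a M) = (e + 1 : ℕ) :=
    supportDim_quotSMulTop_eq hd ha haP
  set P' := (Module.annihilator R (QuotSMulTop a M)).minimalPrimes
  have hP'm : maximalIdeal R ∉ P' := maximalIdeal_notMem_minimalPrimes (by
    rw [hdim1]; exact_mod_cast Nat.succ_le_succ (Nat.zero_le _))
  -- Avoiding `P'` as well makes `a, b` the start of a system of parameters. Then `bu = b²v` for `u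
  -- ∈ U`, and regularity modulo `U` puts `v` in `U`; so `bU = b(bU)`, and Nakayama gives `bU = 0`.
  have hkill : ∀ b ∈ maximalIdeal R, (∀ p ∈ P ∪ P', b ∉ p) → b ∈ U.annihilator := by
    intro b hb hbP
    have hbreg := hreg b hb fun p hp => hbP p (Or.inl hp)
    obtain ⟨z, hz, hzprim⟩ := exists_isPrimaryOn_range
      (supportDim_quotSMulTop_eq hdim1 hb fun p hp => hbP p (Or.inr hp))
    have hsop : IsSystemOfParameters R M (Fin.cons a (Fin.cons b z) : Fin (e + 2) → R) := by
      refine isSystemOfParameters_iff.mpr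
        ⟨hd, fun i => Fin.cases ha (fun i => Fin.cases hb hz i) i, ?_⟩
      rw [Fin.range_cons, Fin.range_cons]
      exact isPrimaryOn_insert (isPrimaryOn_insert hzprim)
    have hW : U.map (LinearMap.lsmul R M b) = ⊥ := by
      refine eq_bot_of_le_smul (IsNoetherian.noetherian _) hb ?_
      rintro _ ⟨u, hu, rfl⟩
      have hu' := hu
      rw [SetLike.mem_coe, hU, mem_torsionBy_iff] at hu'
      obtain ⟨v, hv⟩ := exists_smul_eq_sq_smul hP hsop (u := u) hu'
      have hv' : b • u = b • (b • v) := by rw [← mul_smul, ← pow_two]; exact hv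
      refine ⟨b • v, ⟨v, hbreg _ (hbreg _ ?_), rfl⟩, hv'⟩
      rw [← hv']
      exact U.smul_mem _ hu
    rw [Submodule.mem_annihilator]
    intro u hu
    have := Submodule.mem_map_of_mem (f := LinearMap.lsmul R M b) hu
    rw [hW] at this
    simpa using this
  have hmU : maximalIdeal R ≤ U.annihilator :=
    maximalIdeal_le_of_forall_notMem (hfin.union (Ideal.finite_minimalPrimes_of_isNoetherianRing R _))
      (fun p hp => hp.elim (hPp p) fun h => h.1.1) (fun h => h.elim hPm hP'm) hkill
  have hUH : U = H0 (maximalIdeal R) M := by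
    apply le_antisymm
    · intro u hu
      rw [mem_H0_iff]
      refine ⟨1, fun r hr => ?_⟩
      rw [pow_one] at hr
      exact Submodule.mem_annihilator.mp (hmU hr) u hu
    · intro h hh
      obtain ⟨n, hn⟩ := (mem_H0_iff _ _ _).mp hh
      have : ∀ k, a ^ k • h ∈ U → h ∈ U := by
        intro k
        induction k with
        | zero => simp
        | succ k ih =>
          intro hk
          rw [pow_succ', mul_smul] at hk
          exact ih (hreg a ha haP _ hk)
      refine this n ?_
      rw [hn _ (Ideal.pow_mem_pow ha n)]
      exact U.zero_mem
  rw [← hUH]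
  refine ⟨fun r hr h hh => Submodule.mem_annihilator.mp (hmU hr) h hh, ?_⟩
  obtain ⟨z, hz, hzprim⟩ := exists_isPrimaryOn_range hdim1
  refine ⟨Fin.cons a z, isSystemOfParameters_iff.mpr ⟨hd, fun i => Fin.cases ha hz i, ?_⟩,
    fun v hv => hreg a ha haP v hv⟩
  rw [Fin.range_cons]
  exact isPrimaryOn_insert hzprim

/-- The ideal generated by the first `r` elements of a family. -/
def initialIdeal {d : ℕ} (x : Fin d → R) (r : ℕ) : Ideal R :=
  Ideal.span (x '' {i | i.val < r})

omit [IsLocalRing R] [IsNoetherianRing R] in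
theorem initialIdeal_succ {d : ℕ} (x : Fin d → R) {r : ℕ} (hr : r < d) :
    initialIdeal x (r + 1) = initialIdeal x r ⊔ Ideal.span {x ⟨r, hr⟩} := by
  rw [initialIdeal, initialIdeal, ← Ideal.span_union]
  congr 1
  ext z
  simp only [Set.mem_image, Set.mem_ofPred_eq, Set.mem_union, Set.mem_singleton_iff]
  constructor
  · rintro ⟨i, hi, rfl⟩
    by_cases h : i.val < r
    · exact Or.inl ⟨i, h, rfl⟩
    · exact Or.inr (congrArg x (Fin.ext (by simp; omega)))
  · rintro (⟨i, hi, rfl⟩ | rfl)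
    · exact ⟨i, by omega, rfl⟩
    · exact ⟨_, by simp, rfl⟩

/-- Replace `x_r` by `g` and the later parameters by `t`-th powers; `hgs` keeps this a system of
parameters. Squaring a member of index at least `r` leaves `hw` usable, and `hw'` covers the others.
Krull's theorem in `t` removes the later parameters. -/
theorem mem_sq_smul_of_initialIdeal
    (hP : ∀ (d : ℕ) (x : Fin d → R), IsSystemOfParameters R M x →
      HasParametricDecomposition R M x)
    {d : ℕ} {x : Fin d → R} (hx : IsSystemOfParameters R M x) {r : ℕ} (hr : r < d) {g : R}
    (hg : g ∈ maximalIdeal R) {s : ℕ}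
    (hgs : x ⟨r, hr⟩ ^ s ∈ initialIdeal x r ⊔ Ideal.span {g}) {w : M}
    (hw : w ∈ (initialIdeal x r • ⊤ : Submodule R M))
    (hw' : ∀ j : Fin d, j.val < r →
      w ∈ (Ideal.span (x '' {i | i.val < r ∧ i ≠ j} ∪ {x j ^ 2, g}) • ⊤ : Submodule R M)) :
    w ∈ ((initialIdeal x r ⊔ Ideal.span {g}) ^ 2 • ⊤ : Submodule R M) := by
  obtain ⟨hdim, hmem, hprim⟩ := isSystemOfParameters_iff.mp hx
  refine mem_of_forall_mem_sup_pow_smul 1 fun t ht => ?_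
  set y : Fin d → R := fun i =>
    if i.val < r then x i else if i.val = r then g else x i ^ t with hy
  have hy0 : ∀ i : Fin d, i.val < r → y i = x i := fun i hi => by simp [hy, hi]
  have hy1 : y ⟨r, hr⟩ = g := by simp [hy]
  have hy2 : ∀ i : Fin d, r < i.val → y i = x i ^ t := fun i hi => by
    simp [hy, hi.ne', hi.not_gt]
  have hys : ∀ i, y i ∈ Ideal.span (Set.range y) := fun i => Ideal.subset_span ⟨i, rfl⟩
  have hcases : ∀ i : Fin d, i.val < r ∨ i = ⟨r, hr⟩ ∨ r < i.val := fun i => by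
    rcases lt_trichotomy i.val r with h | h | h
    · exact Or.inl h
    · exact Or.inr (Or.inl (Fin.ext h))
    · exact Or.inr (Or.inr h)
  have hysop : IsSystemOfParameters R M y := by
    refine isSystemOfParameters_iff.mpr ⟨hdim, fun i => ?_, hprim.of_pow_mem ?_⟩
    · rcases hcases i with h | rfl | h
      · rw [hy0 i h]; exact hmem i
      · rw [hy1]; exact hg
      · rw [hy2 i h]; exact Ideal.pow_mem_of_mem _ (hmem i) t ht
    · rintro _ ⟨i, rfl⟩
      rcases hcases i with h | rfl | h
      · exact ⟨1, by rw [pow_one, ← hy0 i h]; exact hys i⟩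
      · have hle : initialIdeal x r ⊔ Ideal.span {g} ≤ Ideal.span (Set.range y) := by
          refine sup_le (Ideal.span_le.mpr ?_) (Ideal.span_le.mpr ?_)
          · rintro _ ⟨i, hi, rfl⟩
            rw [← hy0 i hi]; exact hys i
          · rintro _ rfl
            rw [← hy1]; exact hys _
        exact ⟨s, hle hgs⟩
      · exact ⟨t, by rw [← hy2 i h]; exact hys i⟩
  have key : w ∈ (Ideal.span (Set.range y) ^ 2 • ⊤ : Submodule R M) := by
    refine (hP _ y hysop).mem_sq fun j => ?_
    by_cases hj : j.val < r
    · refine Submodule.smul_mono_left (Ideal.span_le.mpr ?_) (hw' j hj)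
      rintro _ (⟨i, ⟨hi, hij⟩, rfl⟩ | rfl | rfl)
      · exact Ideal.subset_span ⟨i, by rw [Function.update_of_ne hij, hy0 i hi]⟩
      · exact Ideal.subset_span ⟨j, by rw [Function.update_self, hy0 j hj]⟩
      · refine Ideal.subset_span ⟨⟨r, hr⟩, ?_⟩
        rw [Function.update_of_ne (by rintro rfl; exact lt_irrefl _ hj), hy1]
    · refine Submodule.smul_mono_left (Ideal.span_le.mpr ?_) hw
      rintro _ ⟨i, hi, rfl⟩
      exact Ideal.subset_span ⟨i, by
        rw [Function.update_of_ne (by rintro rfl; exact hj hi), hy0 i hi]⟩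
  refine sq_smul_le_of_le_sup (Ideal.span_le.mpr ?_) key
  rintro _ ⟨i, rfl⟩
  rcases hcases i with h | rfl | h
  · rw [hy0 i h]
    exact Ideal.mem_sup_left (Ideal.mem_sup_left (Ideal.subset_span ⟨i, h, rfl⟩))
  · rw [hy1]
    exact Ideal.mem_sup_left (Ideal.mem_sup_right (Ideal.mem_span_singleton_self _))
  · rw [hy2 i h]
    exact Ideal.mem_sup_right (Ideal.pow_mem_pow (hmem i) t)

omit [IsLocalRing R] [IsNoetherianRing R] [Module.Finite R M] in
theorem exists_eq_add_of_mem_sq_smul {I : Ideal R} {g : R} {w : M}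
    (hw : w ∈ ((I ⊔ Ideal.span {g}) ^ 2 • ⊤ : Submodule R M)) :
    ∃ p ∈ (I ^ 2 • ⊤ : Submodule R M), ∃ q ∈ (I • ⊤ : Submodule R M), ∃ n : M,
      w = p + g • q + (g * g) • n := by
  have hle : (I ⊔ Ideal.span {g}) ^ 2 ≤
      I ^ 2 ⊔ Ideal.span {g} * I ⊔ Ideal.span {g * g} := by
    simp only [pow_two, Ideal.sup_mul, Ideal.mul_sup, Ideal.span_singleton_mul_span_singleton]
    refine sup_le (sup_le ?_ ?_) (sup_le ?_ ?_)
    · exact le_sup_of_le_left le_sup_left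
    · exact le_sup_of_le_left le_sup_right
    · rw [mul_comm]; exact le_sup_of_le_left le_sup_right
    · exact le_sup_right
  have h := Submodule.smul_mono_left hle hw
  rw [Submodule.sup_smul, Submodule.sup_smul, Submodule.mul_smul,
    Submodule.ideal_span_singleton_smul, Submodule.ideal_span_singleton_smul] at h
  obtain ⟨a, ha, b, ⟨n, -, rfl⟩, rfl⟩ := Submodule.mem_sup.mp h
  obtain ⟨p, hp, b, ⟨q, hq, rfl⟩, rfl⟩ := Submodule.mem_sup.mp ha
  exact ⟨p, hp, q, hq, n, rfl⟩

omit [IsLocalRing R] [IsNoetherianRing R] [Module.Finite R M] in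
theorem exists_eq_add_of_mem_sup_smul {I J : Ideal R} {c : R} {w : M}
    (hw : w ∈ ((J ⊔ Ideal.span {c}) • I • ⊤ : Submodule R M)) :
    ∃ p ∈ (J • ⊤ : Submodule R M), ∃ q ∈ (I • ⊤ : Submodule R M), w = p + c • q := by
  rw [Submodule.sup_smul, Submodule.ideal_span_singleton_smul] at hw
  obtain ⟨p, hp, b, ⟨q, hq, rfl⟩, rfl⟩ := Submodule.mem_sup.mp hw
  exact ⟨p, Submodule.smul_mono le_rfl le_top hp, q, hq, rfl⟩

omit [IsLocalRing R] [IsNoetherianRing R] [Module.Finite R M] in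
theorem pow_smul_mem_of_le {L : Submodule R M} {z : R} {v : M} {k l : ℕ} (hkl : k ≤ l)
    (h : z ^ k • v ∈ L) : z ^ l • v ∈ L := by
  rw [← Nat.sub_add_cancel hkl, pow_add, mul_smul]
  exact L.smul_mem _ h

/-- With `I` generated by the first `r + 1` parameters, `z` the next one and `C` the stable colon of
`I²M` by powers of `z`, two inclusions suffice: `stepA` bounds the stable colon of `IM` by `IM + C`,
and `stepB` bounds `C` by `IM + H`. -/
theorem mem_initialIdeal_sup_succ
    (hP : ∀ (d : ℕ) (x : Fin d → R), IsSystemOfParameters R M x →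
      HasParametricDecomposition R M x)
    {d : ℕ} {x : Fin d → R} (hx : IsSystemOfParameters R M x) {H : Submodule R M}
    (hH : ∀ r ∈ maximalIdeal R, ∀ h ∈ H, r • h = 0) {r : ℕ} (hr : r + 1 < d)
    (ih : ∀ u : M, x ⟨r, by omega⟩ • u ∈ initialIdeal x r • ⊤ ⊔ H →
      u ∈ initialIdeal x r • ⊤ ⊔ H) (u : M)
    (hu : x ⟨r + 1, hr⟩ • u ∈ initialIdeal x (r + 1) • ⊤ ⊔ H) :
    u ∈ initialIdeal x (r + 1) • ⊤ ⊔ H := by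
  have hmem := hx.mem_maximalIdeal
  have hr' : r < d := by omega
  set c := x ⟨r, hr'⟩ with hc
  set z := x ⟨r + 1, hr⟩ with hz
  set J := initialIdeal x r with hJ
  set I := initialIdeal x (r + 1) with hI
  have hIJ : I = J ⊔ Ideal.span {c} := initialIdeal_succ x hr'
  have hcI : c ∈ I := hIJ ▸ Ideal.mem_sup_right (Ideal.mem_span_singleton_self c)
  obtain ⟨K₁, hK₁⟩ := exists_forall_pow_smul_mem (I • ⊤ : Submodule R M) z
  obtain ⟨K₂, hK₂⟩ := exists_forall_pow_smul_mem (I ^ 2 • ⊤ : Submodule R M) z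
  set C : Submodule R M := (I ^ 2 • ⊤ : Submodule R M).comap (LinearMap.lsmul R M (z ^ K₂))
    with hC
  -- Taking `g = z^s`, one gets `z^s u = p + z^s q + z^(2s) n` with `p ∈ I²M` and `q ∈ IM`, so `u -
  -- q - z^s n` lies in `C`; then let `s` grow.
  have stepA : ∀ u : M, z ^ K₁ • u ∈ (I • ⊤ : Submodule R M) →
      u ∈ (I • ⊤ : Submodule R M) ⊔ C := by
    intro u hu
    refine mem_of_forall_mem_sup_pow_smul (max K₁ 1) fun s hs => ?_
    have hsu : z ^ s • u ∈ (I • ⊤ : Submodule R M) :=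
      pow_smul_mem_of_le ((le_max_left _ _).trans hs) hu
    have hzs : z ^ s ∈ maximalIdeal R :=
      Ideal.pow_mem_of_mem _ (hmem _) s ((le_max_right _ _).trans hs)
    have h1 := mem_sq_smul_of_initialIdeal hP hx hr hzs (s := s)
      (Ideal.mem_sup_right (Ideal.mem_span_singleton_self _)) hsu fun j hj =>
      Submodule.smul_mem_smul (Ideal.subset_span (Or.inr (Or.inr rfl))) trivial
    obtain ⟨p, hp, q, hq, n, hn⟩ := exists_eq_add_of_mem_sq_smul h1
    have h2 : u - q - z ^ s • n ∈ C := by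
      refine hK₂ s _ ?_
      rw [smul_sub, smul_sub, hn, smul_smul]
      convert hp using 1
      abel
    rw [show u = (q + (u - q - z ^ s • n)) + z ^ s • n by abel]
    exact add_mem (Submodule.mem_sup_left (Submodule.add_mem_sup hq h2))
      (Submodule.mem_sup_right (Submodule.smul_mem_smul (Ideal.pow_mem_pow (hmem _) s) trivial))
  have stepB : ∀ v ∈ C, v ∈ (I • ⊤ : Submodule R M) ⊔ H := by
    intro v hv
    refine mem_of_forall_mem_sup_pow_smul (max K₂ 1) fun s hs => ?_
    have hsK : K₂ ≤ s := (le_max_left _ _).trans hs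
    have hsv : z ^ s • v ∈ (I ^ 2 • ⊤ : Submodule R M) := pow_smul_mem_of_le hsK hv
    have hzs : z ^ s ∈ maximalIdeal R :=
      Ideal.pow_mem_of_mem _ (hmem _) s ((le_max_right _ _).trans hs)
    have hcv : c • v ∈ (I • ⊤ : Submodule R M) := Submodule.smul_mem_smul hcI trivial
    -- The choice `g = c + z^s` handles the squaring of `c`: `cv = gv - z^s v`, where `z^s v ∈ I²M`
    -- and `I²` lies in `(c²) + J`. If another member is squared, `c` itself is still a generator.
    have h1 : c • v ∈ ((I ⊔ Ideal.span {c + z ^ s}) ^ 2 • ⊤ : Submodule R M) := by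
      refine mem_sq_smul_of_initialIdeal hP hx hr (add_mem (hmem _) hzs) (s := s) ?_ hcv ?_
      · have h3 : (c + z ^ s) - c ∈ I ⊔ Ideal.span {c + z ^ s} :=
          sub_mem (Ideal.mem_sup_right (Ideal.mem_span_singleton_self _))
            (Ideal.mem_sup_left hcI)
        rwa [add_sub_cancel_left] at h3
      · intro j hj
        by_cases hjr : j.val = r
        · obtain rfl : j = ⟨r, hr'⟩ := Fin.ext hjr
          rw [show c • v = (c + z ^ s) • v - z ^ s • v by rw [add_smul]; abel]
          refine sub_mem
            (Submodule.smul_mem_smul (Ideal.subset_span (Or.inr (Or.inr rfl))) trivial) ?_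
          have h2 := sq_smul_le_of_le_sup (hIJ.le.trans (sup_comm _ _).le) hsv
          rw [← Submodule.sup_smul] at h2
          refine Submodule.smul_mono_left (sup_le ?_ (Ideal.span_le.mpr ?_)) h2
          · rw [Ideal.span_singleton_pow, Ideal.span_singleton_le_iff_mem]
            exact Ideal.subset_span (Or.inr (Or.inl rfl))
          · rintro _ ⟨i, hi, rfl⟩
            simp only [Set.mem_ofPred_eq] at hi
            refine Ideal.subset_span (Or.inl ⟨i, ⟨by omega, ?_⟩, rfl⟩)
            rintro rfl
            simp at hi
        · refine Submodule.smul_mem_smul (Ideal.subset_span (Or.inl ⟨⟨r, hr'⟩, ⟨by simp, ?_⟩, rfl⟩))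
            trivial
          rintro rfl
          simp at hjr
    have h2 : c • v ∈ ((I ⊔ Ideal.span {z ^ s}) ^ 2 • ⊤ : Submodule R M) := by
      refine Submodule.smul_mono_left (Ideal.pow_right_mono (sup_le le_sup_left ?_) 2) h1
      rw [Ideal.span_singleton_le_iff_mem]
      exact add_mem (Ideal.mem_sup_left hcI)
        (Ideal.mem_sup_right (Ideal.mem_span_singleton_self _))
    obtain ⟨p, hp, q, hq, n, hn⟩ := exists_eq_add_of_mem_sq_smul h2
    have hn' : (z ^ s * z ^ s) • n ∈ (I • ⊤ : Submodule R M) := by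
      rw [show (z ^ s * z ^ s) • n = c • v - p - z ^ s • q by rw [hn]; abel]
      exact sub_mem (sub_mem hcv (Submodule.smul_mono_left (Ideal.pow_le_self two_ne_zero) hp))
        (Submodule.smul_mem _ _ hq)
    rw [← pow_add] at hn'
    -- Splitting `n` by `stepA` absorbs `z^(2s) n` into the other two terms. Sorting by `I = J +
    -- (c)` then gives `c(v - p₂ - z^s q₂) ∈ JM`, to which the induction hypothesis on `c` applies.
    obtain ⟨n₁, hn₁, n₂, hn₂, rfl⟩ := Submodule.mem_sup.mp (stepA n (hK₁ _ _ hn'))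
    have hp' : p + z ^ (s + s) • n₂ ∈ (I ^ 2 • ⊤ : Submodule R M) :=
      add_mem hp (pow_smul_mem_of_le (by omega) hn₂)
    have hq' : q + z ^ s • n₁ ∈ (I • ⊤ : Submodule R M) :=
      add_mem hq (Submodule.smul_mem _ _ hn₁)
    rw [pow_two, Submodule.mul_smul] at hp'
    nth_rewrite 1 [hIJ] at hp'
    obtain ⟨p₁, hp₁, p₂, hp₂, hpe⟩ := exists_eq_add_of_mem_sup_smul hp'
    rw [hIJ, ← Submodule.top_smul (R := R) (⊤ : Submodule R M)] at hq'
    obtain ⟨q₁, hq₁, q₂, -, hqe⟩ := exists_eq_add_of_mem_sup_smul hq'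
    have hcv' : c • v = (p₁ + c • p₂) + z ^ s • (q₁ + c • q₂) := by
      rw [← hpe, ← hqe, hn, pow_add, smul_add, smul_add, smul_smul]
      abel
    have h3 : v - p₂ - z ^ s • q₂ ∈ (J • ⊤ : Submodule R M) ⊔ H := by
      refine ih _ (Submodule.mem_sup_left ?_)
      rw [show c • (v - p₂ - z ^ s • q₂) = p₁ + z ^ s • q₁ by
        rw [smul_sub, smul_sub, hcv', smul_add, smul_comm (z ^ s) c q₂]; abel]
      exact add_mem hp₁ (Submodule.smul_mem _ _ hq₁)
    rw [show v = ((v - p₂ - z ^ s • q₂) + p₂) + z ^ s • q₂ by abel]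
    refine add_mem (Submodule.mem_sup_left (add_mem ?_ (Submodule.mem_sup_left hp₂)))
      (Submodule.mem_sup_right (Submodule.smul_mem_smul (Ideal.pow_mem_pow (hmem _) s) trivial))
    exact sup_le_sup_right (Submodule.smul_mono_left (hIJ ▸ le_sup_left)) H h3
  obtain ⟨a, ha, h, hh, hah⟩ := Submodule.mem_sup.mp hu
  -- A second factor `z` kills the component in `H`.
  have hz2 : z ^ 2 • u ∈ (I • ⊤ : Submodule R M) := by
    rw [pow_two, mul_smul, ← hah, smul_add, hH z (hmem _) h hh, add_zero]
    exact Submodule.smul_mem _ _ ha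
  exact (sup_le le_sup_left stepB : (I • ⊤ : Submodule R M) ⊔ C ≤ I • ⊤ ⊔ H)
    (stepA u (hK₁ 2 u hz2))

theorem mem_initialIdeal_sup
    (hP : ∀ (d : ℕ) (x : Fin d → R), IsSystemOfParameters R M x →
      HasParametricDecomposition R M x)
    {d : ℕ} (hd : 0 < d) {x : Fin d → R} (hx : IsSystemOfParameters R M x) {H : Submodule R M}
    (hH : ∀ r ∈ maximalIdeal R, ∀ h ∈ H, r • h = 0)
    (h0 : ∀ v : M, x ⟨0, hd⟩ • v ∈ H → v ∈ H) {r : ℕ} (hr : r < d) (u : M)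
    (hu : x ⟨r, hr⟩ • u ∈ initialIdeal x r • ⊤ ⊔ H) : u ∈ initialIdeal x r • ⊤ ⊔ H := by
  induction r generalizing u with
  | zero =>
    have : initialIdeal x 0 = ⊥ := by simp [initialIdeal]
    rw [this, Submodule.bot_smul, bot_sup_eq] at hu ⊢
    exact h0 u hu
  | succ r ih => exact mem_initialIdeal_sup_succ hP hx hH hr (ih (by omega)) u hu

end Necessity

/-! ### Systems of parameters on Cohen–Macaulay modules are regular. -/

section CohenMacaulay

variable {R : Type u} [CommRing R] [IsLocalRing R]

variable (R) in
/-- There is a weakly regular sequence of length `n` in the maximal ideal. -/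
def HasRegularSequence (N : Type v) [AddCommGroup N] [Module R N] (n : ℕ) : Prop :=
  ∃ rs : List R, rs.length = n ∧ (∀ r ∈ rs, r ∈ maximalIdeal R) ∧ IsWeaklyRegular N rs

theorem hasRegularSequence_succ_iff {N : Type v} [AddCommGroup N] [Module R N] {n : ℕ} :
    HasRegularSequence R N (n + 1) ↔ ∃ y ∈ maximalIdeal R, IsSMulRegular N y ∧
      HasRegularSequence R (QuotSMulTop y N) n := by
  constructor
  · rintro ⟨_ | ⟨y, rs⟩, hlen, hmem, hreg⟩
    · simp at hlen
    · rw [isWeaklyRegular_cons_iff] at hreg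
      exact ⟨y, hmem y (by simp), hreg.1, rs, by simpa using hlen,
        fun r hr => hmem r (by simp [hr]), hreg.2⟩
  · rintro ⟨y, hy, hreg, rs, rfl, hmem, hrs⟩
    exact ⟨y :: rs, rfl, List.forall_mem_cons.mpr ⟨hy, hmem⟩, hrs.cons hreg⟩

omit [IsLocalRing R] in
theorem mkQ_smul_top_smul {N : Type v} [AddCommGroup N] [Module R N] (y : R) (v : N) :
    mkQ (y • (⊤ : Submodule R N)) (y • v) = 0 := by
  rw [Submodule.mkQ_apply, Submodule.Quotient.mk_eq_zero]
  exact Submodule.smul_mem_pointwise_smul v y ⊤ Submodule.mem_top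

variable [IsNoetherianRing R]

/-- The submodule form of the bound of depth by the dimensions of associated primes. Replace `W` by
its saturation `V` under `y`, whose dimension is no larger because `y^K` embeds `V` in `W`. By
Nakayama `V` has nonzero image in `N/yN`, and induction applies there. -/
theorem HasRegularSequence.le_supportDim {n : ℕ} {N : Type v} [AddCommGroup N] [Module R N]
    [Module.Finite R N] (h : HasRegularSequence R N n) {W : Submodule R N} (hW : W ≠ ⊥) :
    (n : WithBot ℕ∞) ≤ Module.supportDim R W := by
  induction n generalizing N with
  | zero =>
    have : Nontrivial W := Submodule.nontrivial_iff_ne_bot.mpr hW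
    obtain ⟨k, hk⟩ :=
      WithBot.ne_bot_iff_exists.mp (Module.supportDim_ne_bot_of_nontrivial R W)
    rw [← hk]
    exact WithBot.coe_le_coe.mpr zero_le
  | succ n ih =>
    obtain ⟨y, hy, hreg, hq⟩ := hasRegularSequence_succ_iff.mp h
    obtain ⟨K, hK⟩ := exists_forall_pow_smul_mem W y
    set V : Submodule R N := W.comap (LinearMap.lsmul R N (y ^ K)) with hV
    have hWV : W ≤ V := fun w hw => W.smul_mem _ hw
    have hVne : V ≠ ⊥ := fun hb => hW (le_bot_iff.mp (hb ▸ hWV))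
    have hdim : Module.supportDim R V ≤ Module.supportDim R W := by
      refine Module.supportDim_le_of_injective
        ((LinearMap.lsmul R N (y ^ K)).restrict (p := V) (q := W) fun v hv => hv) ?_
      intro a b hab
      exact Subtype.ext (hreg.pow K (congrArg Subtype.val hab))
    have hdimV := Module.supportDim_quotSMulTop_succ_eq_supportDim (hreg.submodule V y) hy
    have hne : V.map (mkQ (y • (⊤ : Submodule R N))) ≠ ⊥ := by
      intro hb
      refine hVne (eq_bot_of_le_smul (IsNoetherian.noetherian V) hy fun w hw => ?_)
      have h1 := Submodule.mem_map_of_mem (f := mkQ (y • (⊤ : Submodule R N))) hw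
      rw [hb] at h1
      have h2 : w ∈ y • (⊤ : Submodule R N) := by simpa using h1
      obtain ⟨v, -, rfl⟩ := h2
      refine ⟨v, hK (K + 1) v ?_, rfl⟩
      rw [pow_succ, mul_smul]
      exact hw
    have h1 := ih hq hne
    have h2 : Module.supportDim R (V.map (mkQ (y • (⊤ : Submodule R N)))) ≤
        Module.supportDim R (QuotSMulTop y V) := by
      have hle : y • (⊤ : Submodule R V) ≤
          LinearMap.ker ((mkQ (y • (⊤ : Submodule R N))).submoduleMap V) := by
        rintro _ ⟨v, -, rfl⟩
        rw [LinearMap.mem_ker]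
        refine Subtype.ext ?_
        exact mkQ_smul_top_smul y v.1
      refine Module.supportDim_le_of_surjective (Submodule.liftQ _ _ hle) ?_
      rw [← LinearMap.range_eq_top, Submodule.range_liftQ, LinearMap.range_eq_top]
      exact LinearMap.submoduleMap_surjective _ _
    calc ((n + 1 : ℕ) : WithBot ℕ∞) = n + 1 := by push_cast; rfl
      _ ≤ Module.supportDim R (QuotSMulTop y V) + 1 := by gcongr; exact h1.trans h2
      _ ≤ Module.supportDim R W := hdimV.le.trans hdim

theorem exists_isSMulRegular {N : Type v} [AddCommGroup N] [Module R N] [Module.Finite R N]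
    (h : ∀ u : N, (∀ r ∈ maximalIdeal R, r • u = 0) → u = 0) :
    ∃ z ∈ maximalIdeal R, IsSMulRegular N z := by
  obtain ⟨z, hz, hz'⟩ := exists_mem_maximalIdeal_forall_notMem (associatedPrimes.finite R N)
    (fun p hp => IsAssociatedPrime.isPrime hp) (by
      intro hm
      obtain ⟨hp, u, hu⟩ := isAssociatedPrime_iff.mp hm
      have hu0 : u = 0 := h u fun r hr => by
        rw [hu, Submodule.mem_colon_singleton] at hr
        exact hr
      rw [hu0] at hu
      exact hp.ne_top (hu.trans (by simp)))
  refine ⟨z, hz, ?_⟩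
  by_contra hn
  have : z ∈ ⋃ p ∈ associatedPrimes R N, (p : Set R) := by
    rw [biUnion_associatedPrimes_eq_compl_regular]
    exact hn
  obtain ⟨p, hp, hzp⟩ := Set.mem_iUnion₂.mp this
  exact hz' p hp hzp

omit [IsNoetherianRing R] in
/-- Socle comparison: `N/xN` has zero socle if `N/yN` has. -/
theorem socle_quotSMulTop_eq_zero {N : Type v} [AddCommGroup N] [Module R N] {x y : R}
    (hy : y ∈ maximalIdeal R) (hyr : IsSMulRegular N y) (hxr : IsSMulRegular N x)
    (h : ∀ u : QuotSMulTop y N, (∀ r ∈ maximalIdeal R, r • u = 0) → u = 0)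
    (u : QuotSMulTop x N) (hu : ∀ r ∈ maximalIdeal R, r • u = 0) : u = 0 := by
  obtain ⟨u, rfl⟩ := Submodule.mkQ_surjective _ u
  have hu' : ∀ r ∈ maximalIdeal R, ∃ v : N, r • u = x • v := by
    intro r hr
    have h1 := hu r hr
    rw [← map_smul, Submodule.mkQ_apply, Submodule.Quotient.mk_eq_zero] at h1
    obtain ⟨v, -, hv⟩ := h1
    exact ⟨v, hv.symm⟩
  -- Sending `u` to the `v` with `yu = xv` carries the socle of `N/xN` into that of `N/yN`;
  -- injectivity of this map is the conclusion.
  obtain ⟨v, hv⟩ := hu' y hy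
  have hv0 : (mkQ (y • (⊤ : Submodule R N))) v = 0 := by
    refine h _ fun r hr => ?_
    obtain ⟨w, hw⟩ := hu' r hr
    have : r • v = y • w := hxr (by
      simp only
      rw [smul_comm x r, ← hv, smul_comm r y, hw, smul_comm])
    rw [← map_smul, this]
    exact mkQ_smul_top_smul y w
  rw [Submodule.mkQ_apply, Submodule.Quotient.mk_eq_zero] at hv0
  obtain ⟨v', -, rfl⟩ := hv0
  have : u = x • v' := hyr (by
    simp only
    rw [hv, smul_comm]; rfl)
  rw [this]
  exact mkQ_smul_top_smul x v'

omit [IsNoetherianRing R] in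
theorem socle_eq_zero_of_isSMulRegular {N : Type v} [AddCommGroup N] [Module R N] {z : R}
    (hz : z ∈ maximalIdeal R) (hreg : IsSMulRegular N z) (u : N)
    (hu : ∀ r ∈ maximalIdeal R, r • u = 0) : u = 0 :=
  hreg (by simp only; rw [hu z hz, smul_zero])

/-- An exchange argument: a third element `z`, regular on both `N/xN` and `N/yN`, links the given
first element `y` to `x`. One passes from `y, z` to `z, y`, then from `z, x` to `x, z`, by
permutability of regular sequences in a local ring. -/
theorem HasRegularSequence.quotSMulTop {n : ℕ} {N : Type v} [AddCommGroup N] [Module R N]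
    [Module.Finite R N] (h : HasRegularSequence R N (n + 1)) {x : R}
    (hx : x ∈ maximalIdeal R) (hxr : IsSMulRegular N x) :
    HasRegularSequence R (QuotSMulTop x N) n := by
  induction n generalizing N x with
  | zero => exact ⟨[], rfl, by simp, .nil R _⟩
  | succ n ih =>
    have swap : ∀ {a b : R} {rs : List R}, a ∈ maximalIdeal R → b ∈ maximalIdeal R →
        (∀ r ∈ rs, r ∈ maximalIdeal R) → IsWeaklyRegular N (a :: b :: rs) →
        IsWeaklyRegular N (b :: a :: rs) := fun ha hb hrs hreg =>
      isWeaklyRegular_of_perm_of_subset_maximalIdeal hreg (List.Perm.swap _ _ _)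
        (List.forall_mem_cons.mpr ⟨ha, List.forall_mem_cons.mpr ⟨hb, hrs⟩⟩)
    obtain ⟨y, hy, hyr, hq⟩ := hasRegularSequence_succ_iff.mp h
    obtain ⟨y', hy', hyr', -⟩ := hasRegularSequence_succ_iff.mp hq
    have hsy := socle_eq_zero_of_isSMulRegular hy' hyr'
    have hsx := socle_quotSMulTop_eq_zero hy hyr hxr hsy
    -- The product has zero socle, so a single `z` serves both factors.
    obtain ⟨z, hz, hzr⟩ := exists_isSMulRegular (R := R)
      (N := QuotSMulTop x N × QuotSMulTop y N) fun u hu =>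
        Prod.ext (hsx _ fun r hr => congrArg Prod.fst (hu r hr))
          (hsy _ fun r hr => congrArg Prod.snd (hu r hr))
    have hzx : IsSMulRegular (QuotSMulTop x N) z := fun a b hab =>
      congrArg Prod.fst (@hzr (a, 0) (b, 0) (Prod.ext hab rfl))
    have hzy : IsSMulRegular (QuotSMulTop y N) z := fun a b hab =>
      congrArg Prod.snd (@hzr (0, a) (0, b) (Prod.ext rfl hab))
    obtain ⟨rs, hlen, hmem, hrs⟩ := ih hq hz hzy
    have h1 := (isWeaklyRegular_cons_iff _ _ _).mp (swap hy hz hmem ((hrs.cons hzy).cons hyr))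
    have h2 := (isWeaklyRegular_cons_iff _ _ _).mp
      (swap hx hz (rs := []) (by simp) (((IsWeaklyRegular.nil R _).cons hzx).cons hxr))
    obtain ⟨rs', hlen', hmem', hrs'⟩ := ih (N := QuotSMulTop z N)
      ⟨y :: rs, by simp [hlen], List.forall_mem_cons.mpr ⟨hy, hmem⟩, h1.2⟩ hx
      ((isWeaklyRegular_cons_iff _ _ _).mp h2.2).1
    have h3 := (isWeaklyRegular_cons_iff _ _ _).mp
      (swap hz hx hmem' ((hrs'.cons ((isWeaklyRegular_cons_iff _ _ _).mp h2.2).1).cons h1.1))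
    exact ⟨z :: rs', by simp [hlen'], List.forall_mem_cons.mpr ⟨hz, hmem'⟩, h3.2⟩

/-- On a Cohen–Macaulay module every system of parameters is regular. -/
theorem HasRegularSequence.isWeaklyRegular {rs : List R} {N : Type v} [AddCommGroup N]
    [Module R N] [Module.Finite R N] (h : HasRegularSequence R N rs.length)
    (hmem : ∀ r ∈ rs, r ∈ maximalIdeal R) (hprim : IsPrimaryOn N {r | r ∈ rs}) :
    IsWeaklyRegular N rs := by
  induction rs generalizing N with
  | nil => exact .nil R _
  | cons x rs ih =>
    have hx : x ∈ maximalIdeal R := hmem x (by simp)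
    have hmem' : ∀ r ∈ rs, r ∈ maximalIdeal R := fun r hr => hmem r (by simp [hr])
    have hprim' : IsPrimaryOn (QuotSMulTop x N) {r | r ∈ rs} :=
      isPrimaryOn_quotSMulTop (by convert hprim using 1; ext; simp)
    -- A nonzero `x`-torsion submodule would have dimension at least `rs.length + 1`, yet its
    -- support lies in that of `N/xN`, of dimension at most `rs.length`.
    have hreg : IsSMulRegular N x := by
      rw [isSMulRegular_iff_torsionBy_eq_bot]
      by_contra hne
      have h1 := h.le_supportDim hne
      have h2 : Module.supportDim R (torsionBy R N x) ≤
          Module.supportDim R (QuotSMulTop x N) := by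
        have hsub : Module.support R (torsionBy R N x) ⊆
            Module.support R (QuotSMulTop x N) := by
          intro p hp
          rw [Module.support_quotSMulTop]
          refine ⟨Module.support_subset_of_injective _ (Submodule.subtype_injective _) hp, ?_⟩
          refine fun y hy => Module.annihilator_le_of_mem_support hp ?_
          rw [Set.mem_singleton_iff.mp hy, Module.mem_annihilator]
          exact fun m => smul_torsionBy x m
        exact Order.krullDim_le_of_strictMono (fun a => ⟨a.1, hsub a.2⟩) fun _ _ lt => lt
      have h3 := h1.trans (h2.trans (hprim'.supportDim_le hmem'))
      have h4 : (x :: rs).length ≤ rs.length := by exact_mod_cast h3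
      simp at h4
    exact (ih (h.quotSMulTop hx hreg) hmem' hprim').cons hreg

end CohenMacaulay

/-! ### Monomial ideals in a regular sequence, modulo a base submodule. -/

section Monomial

variable {R : Type u} [CommRing R] {M : Type v} [AddCommGroup M] [Module R M] {ι : Type*}

theorem sup_pow_succ_le (I J : Ideal R) (n k : ℕ) :
    (I ⊔ J) ^ (n + k + 1) ≤ I ^ (n + 1) ⊔ J ^ (k + 1) := by
  rw [← Ideal.add_eq_sup, ← Ideal.add_eq_sup, add_pow, Ideal.sum_eq_sup]
  refine Finset.sup_le fun i hi => ?_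
  rw [Finset.mem_range] at hi
  refine Ideal.mul_le_left.trans ?_
  by_cases hn : n + 1 ≤ i
  · exact le_sup_of_le_left (Ideal.mul_le_left.trans (Ideal.pow_le_pow_right hn))
  · refine le_sup_of_le_right (Ideal.mul_le_right.trans (Ideal.pow_le_pow_right ?_))
    omega

/-- The ideal generated by the powers `x i ^ α i` for `i ∈ S`. -/
def powIdeal (x : ι → R) (α : ι → ℕ) (S : Finset ι) : Ideal R :=
  Ideal.span ((fun i => x i ^ α i) '' S)

theorem pow_mem_powIdeal (x : ι → R) (α : ι → ℕ) {S : Finset ι} {i : ι} (hi : i ∈ S) :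
    x i ^ α i ∈ powIdeal x α S :=
  Ideal.subset_span ⟨i, hi, rfl⟩

theorem powIdeal_insert [DecidableEq ι] (x : ι → R) (α : ι → ℕ) (z : ι) (S : Finset ι) :
    powIdeal x α (insert z S) = Ideal.span {x z ^ α z} ⊔ powIdeal x α S := by
  rw [powIdeal, Finset.coe_insert, Set.image_insert_eq, Ideal.span_insert, powIdeal]

theorem powIdeal_empty (x : ι → R) (α : ι → ℕ) : powIdeal x α ∅ = ⊥ := by
  simp [powIdeal]

theorem powIdeal_congr {x : ι → R} {α β : ι → ℕ} {S : Finset ι} (h : ∀ i ∈ S, α i = β i) :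
    powIdeal x α S = powIdeal x β S := by
  rw [powIdeal, powIdeal, Set.image_congr fun i hi => by rw [h i hi]]

theorem powIdeal_anti {x : ι → R} {α β : ι → ℕ} {S : Finset ι} (h : ∀ i ∈ S, α i ≤ β i) :
    powIdeal x β S ≤ powIdeal x α S := by
  refine Ideal.span_le.mpr ?_
  rintro _ ⟨i, hi, rfl⟩
  exact Ideal.mem_of_dvd _ (pow_dvd_pow _ (h i hi)) (pow_mem_powIdeal x α hi)

theorem span_pow_le_powIdeal (x : ι → R) (S : Finset ι) (β : ι → ℕ) {m : ℕ}
    (h : ∑ i ∈ S, β i ≤ m) :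
    Ideal.span (x '' S) ^ (m + 1) ≤ powIdeal x (fun i => β i + 1) S := by
  classical
  induction S using Finset.induction_on generalizing m with
  | empty => simp [pow_succ]
  | insert z S hz ih =>
    rw [Finset.sum_insert hz] at h
    rw [powIdeal_insert, Finset.coe_insert, Set.image_insert_eq, Ideal.span_insert]
    have hm : m + 1 = β z + (m - β z) + 1 := by omega
    rw [hm]
    refine (sup_pow_succ_le _ _ _ _).trans (sup_le_sup ?_ (ih (by omega)))
    rw [Ideal.span_singleton_pow]

/-- Each `x i`, `i ∈ S`, is regular modulo `L` and arbitrary powers of the other members. -/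
def IsStronglyRegular (L : Submodule R M) (x : ι → R) (S : Finset ι) : Prop :=
  ∀ (α : ι → ℕ), ∀ T ⊆ S, ∀ i ∈ S, i ∉ T → ∀ u : M,
    x i • u ∈ L ⊔ powIdeal x α T • ⊤ → u ∈ L ⊔ powIdeal x α T • ⊤

theorem IsStronglyRegular.mono {L : Submodule R M} {x : ι → R} {S T : Finset ι}
    (h : IsStronglyRegular L x S) (hT : T ⊆ S) : IsStronglyRegular L x T :=
  fun α T' hT' i hi => h α T' (hT'.trans hT) i (hT hi)

theorem IsStronglyRegular.sup_pow [DecidableEq ι] {L : Submodule R M} {x : ι → R} {S : Finset ι}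
    {z : ι} (hz : z ∉ S) (h : IsStronglyRegular L x (insert z S)) (b : ℕ) :
    IsStronglyRegular (L ⊔ Ideal.span {x z ^ b} • ⊤) x S := by
  intro α T hT i hi hiT u
  have key : L ⊔ Ideal.span {x z ^ b} • (⊤ : Submodule R M) ⊔ powIdeal x α T • ⊤ =
      L ⊔ powIdeal x (Function.update α z b) (insert z T) • ⊤ := by
    rw [powIdeal_insert, Submodule.sup_smul, Function.update_self, sup_assoc]
    congr 3
    refine powIdeal_congr fun j hj => ?_
    rw [Function.update_of_ne]
    rintro rfl
    exact hz (hT hj)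
  rw [key]
  refine h _ _ (Finset.insert_subset_insert z hT) i (Finset.mem_insert_of_mem hi) ?_ u
  rw [Finset.mem_insert, not_or]
  refine ⟨?_, hiT⟩
  rintro rfl
  exact hz hi

theorem mem_of_pow_smul_mem {L : Submodule R M} {z : R} (h : ∀ u : M, z • u ∈ L → u ∈ L)
    (k : ℕ) (u : M) (hu : z ^ k • u ∈ L) : u ∈ L := by
  induction k generalizing u with
  | zero => simpa using hu
  | succ k ih =>
    rw [pow_succ, mul_smul] at hu
    exact h _ (ih _ hu)

/-- Parametric decomposition of powers for regular sequences (Heinzer, Ratliff and Shah),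
relative to a base submodule. -/
theorem IsStronglyRegular.mem_sup_pow_smul {L : Submodule R M} {x : ι → R} {S : Finset ι}
    (h : IsStronglyRegular L x S) {m : ℕ} {w : M}
    (hw : ∀ β : ι → ℕ, ∑ i ∈ S, β i ≤ m →
      w ∈ L ⊔ powIdeal x (fun i => β i + 1) S • (⊤ : Submodule R M)) :
    w ∈ L ⊔ Ideal.span (x '' S) ^ (m + 1) • (⊤ : Submodule R M) := by
  classical
  induction S using Finset.induction_on generalizing L m w with
  | empty =>
    have := hw 0 (by simp)
    rw [powIdeal_empty, Submodule.bot_smul, sup_bot_eq] at this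
    exact Submodule.mem_sup_left this
  | insert z S hz ih =>
    set J := Ideal.span (x '' (S : Set ι)) with hJ
    set Q := Ideal.span (x '' ((insert z S : Finset ι) : Set ι)) with hQ
    have hQJ : Q = Ideal.span {x z} ⊔ J := by
      rw [hQ, Finset.coe_insert, Set.image_insert_eq, Ideal.span_insert]
    -- The induction hypothesis writes `L + J^k M` as an intersection of submodules `L +
    -- (x_i^(β_i+1))M`; `x z` is regular modulo each.
    have hreg : ∀ k, ∀ u : M, x z • u ∈ L ⊔ J ^ k • (⊤ : Submodule R M) →
        u ∈ L ⊔ J ^ k • (⊤ : Submodule R M) := by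
      intro k u hu
      cases k with
      | zero => simp
      | succ k =>
        refine ih (h.mono (Finset.subset_insert z S)) fun β hβ => ?_
        refine h _ S (Finset.subset_insert z S) z (Finset.mem_insert_self z S) hz u ?_
        exact sup_le_sup_left (Submodule.smul_mono_left (span_pow_le_powIdeal x S β hβ)) L hu
    -- Fix the exponent `b + 1` of `x z`, absorb that power into the base submodule and apply the
    -- induction hypothesis with the remaining degree `m - b`.
    have hslice : ∀ b ≤ m, w ∈ L ⊔ Ideal.span {x z ^ (b + 1)} • (⊤ : Submodule R M) ⊔
        J ^ (m - b + 1) • (⊤ : Submodule R M) := by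
      intro b hb
      refine ih (h.sup_pow hz (b + 1)) fun β hβ => ?_
      have hsum : ∑ i ∈ S, Function.update β z b i = ∑ i ∈ S, β i :=
        Finset.sum_congr rfl fun i hi => by
          rw [Function.update_of_ne]
          rintro rfl
          exact hz hi
      have h1 := hw (Function.update β z b) (by
        rw [Finset.sum_insert hz, Function.update_self, hsum]
        omega)
      rw [powIdeal_insert, Submodule.sup_smul, Function.update_self, ← sup_assoc] at h1
      rwa [powIdeal_congr (β := fun i => β i + 1) fun i hi => by
        rw [Function.update_of_ne]
        rintro rfl
        exact hz hi] at h1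
    -- Raise the power of `J` one step at a time. The slice `b = m - k` leaves an error `x_z^(m-k+1)
    -- c`; by regularity `c ∈ L + J^k M`, so the error lies in `L + Q^(m+1) M`, the degrees adding
    -- up to `m + 1`.
    have hdesc : ∀ k ≤ m + 1, w ∈ L ⊔ J ^ k • (⊤ : Submodule R M) ⊔
        Q ^ (m + 1) • (⊤ : Submodule R M) := by
      intro k
      induction k with
      | zero => simp
      | succ k ihk =>
        intro hk
        obtain ⟨y, hy, t, ht, rfl⟩ := Submodule.mem_sup.mp (ihk (by omega))
        have hQle : Q ^ (m + 1) • (⊤ : Submodule R M) ≤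
            L ⊔ Ideal.span {x z ^ (m - k + 1)} • ⊤ ⊔ J ^ (k + 1) • ⊤ := by
          rw [sup_assoc, ← Submodule.sup_smul]
          refine le_sup_of_le_right (Submodule.smul_mono_left ?_)
          rw [hQJ, show m + 1 = (m - k) + k + 1 by omega, ← Ideal.span_singleton_pow]
          exact sup_pow_succ_le _ _ _ _
        have h1 := hslice (m - k) (by omega)
        rw [show m - (m - k) + 1 = k + 1 by omega] at h1
        have h2 : y ∈ L ⊔ Ideal.span {x z ^ (m - k + 1)} • (⊤ : Submodule R M) ⊔
            J ^ (k + 1) • ⊤ := by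
          simpa using sub_mem h1 (hQle ht)
        rw [sup_right_comm, Submodule.ideal_span_singleton_smul] at h2
        obtain ⟨y', hy', _, ⟨c, -, rfl⟩, rfl⟩ := Submodule.mem_sup.mp h2
        have hle : L ⊔ J ^ (k + 1) • (⊤ : Submodule R M) ≤ L ⊔ J ^ k • ⊤ :=
          sup_le_sup_left (Submodule.smul_mono_left (Ideal.pow_le_pow_right k.le_succ)) L
        have hc : x z ^ (m - k + 1) • c ∈ L ⊔ J ^ k • (⊤ : Submodule R M) := by
          simpa using sub_mem hy (hle hy')
        obtain ⟨l, hl, c', hc', rfl⟩ :=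
          Submodule.mem_sup.mp (mem_of_pow_smul_mem (hreg k) _ _ hc)
        have hmem : x z ^ (m - k + 1) • c' ∈ Q ^ (m + 1) • (⊤ : Submodule R M) := by
          have hJQ : J ^ k • (⊤ : Submodule R M) ≤ Q ^ k • ⊤ :=
            Submodule.smul_mono_left (Ideal.pow_right_mono (hQJ ▸ le_sup_right) k)
          have hzQ : x z ∈ Q := hQJ ▸ Ideal.mem_sup_left (Ideal.mem_span_singleton_self _)
          rw [show m + 1 = (m - k + 1) + k by omega, pow_add, Submodule.mul_smul]
          exact Submodule.smul_mem_smul (Ideal.pow_mem_pow hzQ _) (hJQ hc')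
        change y' + x z ^ (m - k + 1) • (l + c') + t ∈ _
        rw [smul_add, ← add_assoc]
        refine add_mem (add_mem (Submodule.mem_sup_left (add_mem hy' ?_))
          (Submodule.mem_sup_right hmem)) (Submodule.mem_sup_right ht)
        exact Submodule.mem_sup_left (L.smul_mem _ hl)
    have := hdesc (m + 1) le_rfl
    have hJQ : J ^ (m + 1) ⊔ Q ^ (m + 1) ≤ Q ^ (m + 1) :=
      sup_le (Ideal.pow_right_mono (hQJ ▸ le_sup_right) (m + 1)) le_rfl
    rw [sup_assoc, ← Submodule.sup_smul] at this
    exact sup_le_sup_left (Submodule.smul_mono_left hJQ) L this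

/-- Remove one generator at a time: the coefficient of `x_z^(α z)` lies in `H` plus the remaining
part by regularity, and its component in `H` is killed by that power. -/
theorem IsStronglyRegular.eq_zero_of_mem {H : Submodule R M} {x : ι → R} {S : Finset ι}
    (h : IsStronglyRegular H x S) {α : ι → ℕ} (hα : ∀ i ∈ S, ∀ v ∈ H, x i ^ α i • v = 0)
    {v : M} (hv : v ∈ H) (hv' : v ∈ powIdeal x α S • (⊤ : Submodule R M)) : v = 0 := by
  classical
  induction S using Finset.induction_on generalizing v with
  | empty => simpa [powIdeal_empty] using hv'
  | insert z S hz ih =>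
    refine ih (h.mono (Finset.subset_insert z S))
      (fun i hi => hα i (Finset.mem_insert_of_mem hi)) hv ?_
    rw [powIdeal_insert, Submodule.sup_smul, Submodule.ideal_span_singleton_smul] at hv'
    obtain ⟨_, ⟨c, -, rfl⟩, y, hy, rfl⟩ := Submodule.mem_sup.mp hv'
    change x z ^ α z • c + y ∈ H at hv
    change x z ^ α z • c + y ∈ _
    have hc : x z ^ α z • c ∈ H ⊔ powIdeal x α S • (⊤ : Submodule R M) := by
      have := sub_mem (Submodule.mem_sup_left (T := powIdeal x α S • (⊤ : Submodule R M)) hv)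
        (Submodule.mem_sup_right hy)
      simpa using this
    obtain ⟨a, ha, c', hc', rfl⟩ := Submodule.mem_sup.mp (mem_of_pow_smul_mem
      (h α S (Finset.subset_insert z S) z (Finset.mem_insert_self z S) hz) _ _ hc)
    rw [smul_add, hα z (Finset.mem_insert_self z S) a ha, zero_add]
    exact add_mem (Submodule.smul_mem _ _ hc') hy

theorem isSMulRegular_quotient_smul_top_iff {H : Submodule R M} {I : Ideal R} {c : R} :
    IsSMulRegular ((M ⧸ H) ⧸ (I • ⊤ : Submodule R (M ⧸ H))) c ↔
      ∀ u : M, c • u ∈ I • ⊤ ⊔ H → u ∈ I • ⊤ ⊔ H := by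
  rw [isSMulRegular_quotient_iff_mem_of_smul_mem, H.mkQ_surjective.forall]
  have h1 := Submodule.comap_smul_top_of_surjective I H.mkQ H.mkQ_surjective
  rw [Submodule.ker_mkQ] at h1
  simp only [← map_smul, ← h1, Submodule.mem_comap]

end Monomial

/-! ### Transfer between `M` and `M/H⁰`, and the two implications. -/

section Main

variable {R : Type u} [CommRing R] [IsLocalRing R] [IsNoetherianRing R]
  {M : Type v} [AddCommGroup M] [Module R M] [Module.Finite R M]

omit [IsNoetherianRing R] [Module.Finite R M] in
theorem nontrivial_quotient_of_smul_eq_zero (hd : 1 ≤ Module.supportDim R M) {H : Submodule R M}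
    (hH : ∀ r ∈ maximalIdeal R, ∀ h ∈ H, r • h = 0) : Nontrivial (M ⧸ H) := by
  refine Submodule.Quotient.nontrivial_iff.mpr ?_
  rintro rfl
  have : IsPrimaryOn (R := R) M ∅ := fun p hp _ => by
    refine le_antisymm (le_maximalIdeal p.2.ne_top) fun r hr => ?_
    exact Module.annihilator_le_of_mem_support hp
      (Module.mem_annihilator.mpr fun v => hH r hr v trivial)
  exact absurd (hd.trans this.supportDim_le_zero) (by decide)

-- At a prime `p ≠ 𝔪` choose `r ∈ 𝔪` outside `p`: if `a` kills `M/H` then `ra` kills `M`, so `a ∈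
-- p`. At `𝔪` nontriviality of `M/H` suffices.
omit [IsNoetherianRing R] in
theorem support_quotient_of_smul_eq_zero {H : Submodule R M} [Nontrivial (M ⧸ H)]
    (hH : ∀ r ∈ maximalIdeal R, ∀ h ∈ H, r • h = 0) :
    Module.support R (M ⧸ H) = Module.support R M := by
  refine (Module.support_subset_of_surjective _ H.mkQ_surjective).antisymm fun p hp => ?_
  rw [Module.mem_support_iff_of_finite] at hp ⊢
  intro a ha
  by_cases hpm : maximalIdeal R ≤ p.asIdeal
  · refine hpm (le_maximalIdeal ?_ ha)
    rw [Ne, Module.annihilator_eq_top_iff]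
    exact not_subsingleton _
  · obtain ⟨r, hr, hrp⟩ := SetLike.not_le_iff_exists.mp hpm
    refine (p.2.mem_or_mem (hp (Module.mem_annihilator.mpr fun v => ?_))).resolve_left hrp
    rw [mul_smul]
    refine hH r hr _ ?_
    have := Module.mem_annihilator.mp ha (H.mkQ v)
    rwa [← map_smul, Submodule.mkQ_apply, Submodule.Quotient.mk_eq_zero] at this

theorem isStronglyRegular_of_hasRegularSequence {H : Submodule R M} {d : ℕ}
    (hreg : HasRegularSequence R (M ⧸ H) d) {x : Fin d → R} (hx : ∀ i, x i ∈ maximalIdeal R)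
    (hprim : IsPrimaryOn (M ⧸ H) (Set.range x)) :
    IsStronglyRegular H x Finset.univ := by
  intro α T _ i _ hiT u hu
  by_cases hα : ∃ j ∈ T, α j = 0
  · obtain ⟨j, hj, hj0⟩ := hα
    have : powIdeal x α T = ⊤ := by
      rw [Ideal.eq_top_iff_one]
      simpa [hj0] using pow_mem_powIdeal x α hj
    simp [this]
  push Not at hα
  -- List the powers indexed by `T`, then `x i`, then the unused parameters: a regular sequence of
  -- length `d`, whose entry `x i` gives the claim.
  set rs := T.toList.map (fun j => x j ^ α j) with hrs
  set rs' := ((insert i T)ᶜ.toList).map x with hrs'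
  have hlen : (rs ++ x i :: rs').length = d := by
    have h1 := Finset.card_le_univ (insert i T)
    simp only [hrs, hrs', List.length_append, List.length_cons, List.length_map,
      Finset.length_toList, Finset.card_compl, Fintype.card_fin]
    rw [Fintype.card_fin] at h1
    rw [Finset.card_insert_of_notMem hiT] at h1 ⊢
    omega
  have hmem : ∀ r ∈ rs ++ x i :: rs', r ∈ maximalIdeal R := by
    intro r hr
    rw [List.mem_append, List.mem_cons] at hr
    rcases hr with hr | rfl | hr
    · obtain ⟨j, hj, rfl⟩ := List.mem_map.mp hr
      exact Ideal.pow_mem_of_mem _ (hx j) _ (Nat.pos_of_ne_zero (hα j (Finset.mem_toList.mp hj)))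
    · exact hx i
    · obtain ⟨j, -, rfl⟩ := List.mem_map.mp hr
      exact hx j
  have hprim' : IsPrimaryOn (M ⧸ H) {r | r ∈ rs ++ x i :: rs'} := by
    refine hprim.of_pow_mem ?_
    rintro _ ⟨j, rfl⟩
    by_cases hjT : j ∈ T
    · exact ⟨α j, Ideal.subset_span (List.mem_append_left _
        (List.mem_map.mpr ⟨j, Finset.mem_toList.mpr hjT, rfl⟩))⟩
    · refine ⟨1, Ideal.subset_span (List.mem_append_right _ ?_)⟩
      rw [pow_one, List.mem_cons]
      by_cases hji : j = i
      · exact Or.inl (by rw [hji])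
      · exact Or.inr (List.mem_map.mpr ⟨j, by simp [hji, hjT], rfl⟩)
  have hw : IsWeaklyRegular (M ⧸ H) (rs ++ x i :: rs') :=
    HasRegularSequence.isWeaklyRegular (by rwa [hlen]) hmem hprim'
  have h2 := ((isWeaklyRegular_cons_iff _ _ _).mp
    ((isWeaklyRegular_append_iff _ _ _).mp hw).2).1
  have hideal : Ideal.ofList rs = powIdeal x α T := by
    rw [Ideal.ofList, powIdeal]
    congr 1
    ext r
    simp [hrs]
  rw [hideal, isSMulRegular_quotient_smul_top_iff, sup_comm] at h2
  exact h2 u hu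

theorem hasParametricDecomposition_of_hasRegularSequence {H : Submodule R M} {d : ℕ} (hd : 0 < d)
    (hH : ∀ r ∈ maximalIdeal R, ∀ h ∈ H, r • h = 0)
    (hreg : HasRegularSequence R (M ⧸ H) d) {x : Fin d → R} (hx : ∀ i, x i ∈ maximalIdeal R)
    (hprim : IsPrimaryOn (M ⧸ H) (Set.range x)) : HasParametricDecomposition R M x := by
  have hs := isStronglyRegular_of_hasRegularSequence hreg hx hprim
  have hpow : ∀ α : Fin d → ℕ,
      Ideal.span (Set.range fun i => x i ^ α i) = powIdeal x α Finset.univ := fun α => by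
    rw [powIdeal, Finset.coe_univ, Set.image_univ]
  have hspan : Ideal.span (Set.range x) = Ideal.span (x '' (Finset.univ : Finset (Fin d))) := by
    rw [Finset.coe_univ, Set.image_univ]
  intro n hn
  obtain ⟨m, rfl⟩ : ∃ m, n = m + 1 := ⟨n - 1, by omega⟩
  have hle : (Ideal.span (Set.range x) ^ (m + 1) • ⊤ : Submodule R M) ≤
      ⨅ α ∈ Lam d (m + 1), (Ideal.span (Set.range fun i => x i ^ α i) • ⊤ : Submodule R M) := by
    refine le_iInf₂ fun α hα => Submodule.smul_mono_left ?_
    have hα' : ∀ i, α i - 1 + 1 = α i := fun i => Nat.sub_add_cancel (hα.1 i)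
    have hsum : ∑ i, (α i - 1) ≤ m := by
      have h1 : ∑ i, (α i - 1) + d = ∑ i, α i := by
        calc ∑ i, (α i - 1) + d = ∑ i, (α i - 1 + 1) := by simp [Finset.sum_add_distrib]
          _ = ∑ i, α i := Finset.sum_congr rfl fun i _ => hα' i
      have := hα.2
      omega
    have h2 := span_pow_le_powIdeal x Finset.univ (fun i => α i - 1) hsum
    simp only [hα'] at h2
    rwa [hspan, hpow]
  refine le_antisymm hle fun w hw => ?_
  simp only [Submodule.mem_iInf] at hw
  -- The monomial lemma asks for all sums at most `m`, while `Lam` fixes the sum. The deficit is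
  -- added to the first exponent, which only shrinks the ideal.
  have hbump : ∀ β : Fin d → ℕ, ∑ i, β i ≤ m → ∃ α ∈ Lam d (m + 1), ∀ i, β i + 1 ≤ α i := by
    intro β hβ
    refine ⟨fun i => β i + 1 + if i = ⟨0, hd⟩ then m - ∑ i, β i else 0,
      ⟨fun i => by simp only; omega, ?_⟩, fun i => by simp⟩
    simp only [Finset.sum_add_distrib, Finset.sum_ite_eq', Finset.mem_univ, if_true,
      Finset.sum_const, Finset.card_univ, Fintype.card_fin, smul_eq_mul, mul_one]
    omega
  have hw' : w ∈ H ⊔ Ideal.span (Set.range x) ^ (m + 1) • (⊤ : Submodule R M) := by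
    rw [hspan]
    refine hs.mem_sup_pow_smul fun β hβ => Submodule.mem_sup_right ?_
    obtain ⟨α, hα, hle⟩ := hbump β hβ
    have h1 := hw α hα
    rw [hpow] at h1
    exact Submodule.smul_mono_left (powIdeal_anti fun i _ => hle i) h1
  obtain ⟨h, hh, y, hy, rfl⟩ := Submodule.mem_sup.mp hw'
  obtain ⟨α, hα, -⟩ := hbump 0 (by simp)
  have hhα : h ∈ powIdeal x α Finset.univ • (⊤ : Submodule R M) := by
    rw [← hpow]
    have h1 := hle hy
    simp only [Submodule.mem_iInf] at h1
    simpa using sub_mem (hw α hα) (h1 α hα)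
  have h0 : h = 0 := hs.eq_zero_of_mem
    (fun i _ v hv => hH _ (Ideal.pow_mem_of_mem _ (hx i) _ (hα.1 i)) v hv) hh hhα
  rw [h0, zero_add]
  exact hy

omit [Module.Finite R M] in
theorem exists_supportDim_eq (hM : 2 ≤ Module.supportDim R M) :
    ∃ e : ℕ, Module.supportDim R M = (e + 2 : ℕ) := by
  have htop : Module.supportDim R M < ⊤ :=
    (Module.supportDim_le_ringKrullDim R M).trans_lt ringKrullDim_lt_top
  obtain ⟨n, hn⟩ := WithBot.ne_bot_iff_exists.mp
    (show Module.supportDim R M ≠ ⊥ by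
      intro h
      rw [h] at hM
      exact absurd hM (by decide))
  rw [← hn] at hM htop ⊢
  have hn' : n ≠ ⊤ := by
    rintro rfl
    exact lt_irrefl _ htop
  lift n to ℕ using hn'
  have h2 : 2 ≤ n := by
    have h3 : ((2 : ℕ) : ℕ∞) ≤ n := WithBot.coe_le_coe.mp hM
    exact_mod_cast h3
  refine ⟨n - 2, ?_⟩
  rw [Nat.sub_add_cancel h2]
  rfl

theorem length_le_of_isRegular {N : Type v} [AddCommGroup N] [Module R N] [Module.Finite R N]
    {d : ℕ} (hd : Module.supportDim R N = d) {rs : List R} (h : IsRegular N rs) :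
    rs.length ≤ d := by
  have h1 := Module.supportDim_add_length_eq_supportDim_of_isRegular rs h
  have : Nontrivial (N ⧸ (Ideal.ofList rs • ⊤ : Submodule R N)) :=
    Submodule.Quotient.nontrivial_iff.mpr h.top_ne_smul.symm
  obtain ⟨k, hk⟩ := WithBot.ne_bot_iff_exists.mp (Module.supportDim_ne_bot_of_nontrivial R
    (N ⧸ (Ideal.ofList rs • ⊤ : Submodule R N)))
  rw [← hk, hd] at h1
  have h2 : k + (rs.length : ℕ∞) = (d : ℕ∞) := by exact_mod_cast h1
  have h3 : (rs.length : ℕ∞) ≤ d := h2 ▸ le_add_self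
  exact_mod_cast h3

theorem hasRegularSequence_of_depth_eq {N : Type v} [AddCommGroup N] [Module R N]
    [Module.Finite R N] {d : ℕ} (hd : Module.supportDim R N = d)
    (h : (depth R N : WithBot ℕ∞) = Module.supportDim R N) : HasRegularSequence R N d := by
  rcases Nat.eq_zero_or_pos d with rfl | hpos
  · exact ⟨[], rfl, by simp, .nil R _⟩
  rw [hd] at h
  have h1 : depth R N = (d : ℕ∞) := by exact_mod_cast h
  -- Being strictly below the supremum yields an actual sequence longer than `d - 1`, and no regular
  -- sequence exceeds `d`; positivity of `d` is needed for the subtraction.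
  have h2 : ((d - 1 : ℕ) : ℕ∞) < depth R N := by
    rw [h1]
    exact_mod_cast Nat.sub_one_lt_of_lt hpos
  rw [depth, lt_iSup_iff] at h2
  obtain ⟨rs, h2⟩ := h2
  rw [lt_iSup_iff] at h2
  obtain ⟨⟨hreg, hmem⟩, h2⟩ := h2
  have h3 : d - 1 < rs.length := by exact_mod_cast h2
  have h4 := length_le_of_isRegular hd hreg
  exact ⟨rs, by omega, hmem, hreg.toIsWeaklyRegular⟩

theorem isCohenMacaulay_of_isWeaklyRegular {N : Type v} [AddCommGroup N] [Module R N]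
    [Module.Finite R N] {d : ℕ} (hd : Module.supportDim R N = d) {rs : List R}
    (hlen : rs.length = d) (hmem : ∀ r ∈ rs, r ∈ maximalIdeal R) (h : IsWeaklyRegular N rs) :
    IsCohenMacaulay R N := by
  right
  have hN : Nontrivial N := by
    rw [← Module.supportDim_ne_bot_iff_nontrivial R, hd]
    exact WithBot.natCast_ne_bot d
  have h1 : depth R N = (d : ℕ∞) := by
    refine le_antisymm (iSup₂_le fun rs hrs => ?_) ?_
    · exact_mod_cast length_le_of_isRegular hd hrs.1
    · rw [← hlen]
      exact le_iSup₂_of_le rs ⟨.of_isWeaklyRegular_of_mem_maximalIdeal N hmem h, hmem⟩ le_rfl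
  rw [h1, hd]
  rfl

omit [IsLocalRing R] [IsNoetherianRing R] [Module.Finite R M] in
theorem isWeaklyRegular_ofFn {H : Submodule R M} {d : ℕ} {x : Fin d → R}
    (h : ∀ (r : ℕ) (hr : r < d) (u : M), x ⟨r, hr⟩ • u ∈ initialIdeal x r • ⊤ ⊔ H →
      u ∈ initialIdeal x r • ⊤ ⊔ H) : IsWeaklyRegular (M ⧸ H) (List.ofFn x) := by
  refine ⟨fun i hi => ?_⟩
  have hi' : i < d := by simpa using hi
  have hideal : Ideal.ofList ((List.ofFn x).take i) = initialIdeal x i := by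
    rw [Ideal.ofList, initialIdeal]
    congr 1
    ext r
    simp only [Set.mem_ofPred_eq, List.mem_take_iff_getElem, List.getElem_ofFn, Set.mem_image,
      List.length_ofFn]
    constructor
    · rintro ⟨j, hj, rfl⟩
      exact ⟨⟨j, by omega⟩, by simp; omega, rfl⟩
    · rintro ⟨j, hj, rfl⟩
      exact ⟨j, by omega, rfl⟩
  rw [hideal, isSMulRegular_quotient_smul_top_iff, List.getElem_ofFn]
  exact h i hi'

end Main

end ParametricDecomposition

theorem corollary1p2 {R : Type*} [CommRing R] [IsNoetherianRing R] [IsLocalRing R]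
    {M : Type*} [AddCommGroup M] [Module R M] [Module.Finite R M]
    (hM : 2 ≤ Module.supportDim R M) :
    (ParametricDecomposition.IsCohenMacaulay R
        (M ⧸ ParametricDecomposition.H0 (IsLocalRing.maximalIdeal R) M) ∧
      IsLocalRing.maximalIdeal R • ParametricDecomposition.H0 (IsLocalRing.maximalIdeal R) M = ⊥) ↔
    ∀ (d : ℕ) (x : Fin d → R), ParametricDecomposition.IsSystemOfParameters R M x →
      ParametricDecomposition.HasParametricDecomposition R M x := by
  open ParametricDecomposition IsLocalRing in
  have hM1 : 1 ≤ Module.supportDim R M := le_trans (by decide) hM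
  constructor
  · rintro ⟨hCM, hann⟩ d x hx
    obtain ⟨hdim, hmem, hprim⟩ := isSystemOfParameters_iff.mp hx
    have hH : ∀ r ∈ maximalIdeal R, ∀ h ∈ H0 (maximalIdeal R) M, r • h = 0 := fun r hr h hh => by
      have := Submodule.smul_mem_smul hr hh
      rwa [hann, Submodule.mem_bot] at this
    have := nontrivial_quotient_of_smul_eq_zero hM1 hH
    have hsupp := support_quotient_of_smul_eq_zero hH
    have hdimN : Module.supportDim R (M ⧸ H0 (maximalIdeal R) M) = d := by
      rw [← hdim, Module.supportDim, Module.supportDim, hsupp]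
    have hd : 0 < d := by
      rw [hdim] at hM1
      exact_mod_cast hM1
    refine hasParametricDecomposition_of_hasRegularSequence hd hH
      (hasRegularSequence_of_depth_eq hdimN (hCM.resolve_left (not_subsingleton _))) hmem ?_
    intro p hp
    exact hprim p (hsupp ▸ hp)
  · intro hP
    obtain ⟨e, he⟩ : ∃ e : ℕ, Module.supportDim R M = (e + 2 : ℕ) :=
      exists_supportDim_eq hM
    obtain ⟨hH, x, hx, h0⟩ := exists_isSystemOfParameters_regular hP he
    have := nontrivial_quotient_of_smul_eq_zero hM1 hH
    have hdimN : Module.supportDim R (M ⧸ H0 (maximalIdeal R) M) = (e + 2 : ℕ) := by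
      rw [← he, Module.supportDim, Module.supportDim, support_quotient_of_smul_eq_zero hH]
    refine ⟨isCohenMacaulay_of_isWeaklyRegular hdimN (List.length_ofFn (f := x)) ?_
      (isWeaklyRegular_ofFn fun r hr u =>
        mem_initialIdeal_sup hP (by omega) hx hH h0 hr u), ?_⟩
    · intro r hr
      obtain ⟨i, rfl⟩ := List.mem_ofFn.mp hr
      exact hx.mem_maximalIdeal i
    · rw [eq_bot_iff, Submodule.smul_le]
      exact fun r hr h hh => (Submodule.mem_bot R).mpr (hH r hr h hh)
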